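/- Let $0<\varepsilon<1/2$ and $q\in(0,1]$. For each $n\ge 1$ let $G_n$ be a connected graph on $n$ vertices with minimum degree $\delta_n$, maximum degree $\Delta_n$ and adjacency eigenvalues $\mu_1\ge\mu_2\ge\dots\ge\mu_n$, and put $\lambda_n=\max_{2\le i\le n}|\mu_i|$. Assume that $(G_n)_{n\ge1}$ is an expander sequence, i.e. $\Delta_n/\delta_n=1+o(1)$ and $\lambda_n=o(\Delta_n)$ as $n\to\infty$. Let $\tilde G_n$ be obtained from $G_n$ by deleting edges so that each vertex keeps at least a $(1/2+\varepsilon)$ fraction of its edges. Both of the following protocols on $\tilde G_n$ start with a single informed vertex $v$ and proceed in rounds. In each round every vertex calls a neighbour in $\tilde G_n$ chosen uniformly at random, and the transmission over each call succeeds with probability $q$, where all choices and successes, over all vertices and rounds, are independent. In push, if $u$ is informed, calls $w$, and the transmission succeeds, then $w$ becomes informed (calls of uninformed vertices have no effect). In push&pull (pp), if $u$ calls $w$, the transmission succeeds, and at least one of $u,w$ was informed at the beginning of the round, then both become informed. For $\mathcal P\in\{push,pp\}$ let $\tilde T_{\mathcal P}(\tilde G_n)$ be the number of rounds until at least $n-n/\log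 n$ vertices are informed ($\log$ is the natural logarithm). Then, with probability tending to $1$ as $n\to\infty$, uniformly in the choice of the initially informed vertex $v$: (a) $\tilde T_{push}(\tilde G_n)=\log_{1+q}(n)+o(\log n)$; (b) if additionally there is $\alpha\in(0,1]$ with $\delta_n\ge\alpha n$ for all sufficiently large $n$, then $\tilde T_{pp}(\tilde G_n)\le\log_{1+2q}(n)+o(\log n)$. Here $X_n=b_n+o(\log n)$ (respectively $X_n\le b_n+o(\log n)$) with probability tending to $1$ means that there is a positive deterministic function $g(n)=o(\log n)$ such that $\mathbb P\big(b_n-g(n)\le X_n\le b_n+g(n)\big)\to1$ (respectively $\mathbb P\big(X_n\le b_n+g(n)\big)\to1$). -/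

import Mathlib

open MeasureTheory Filter Topology Asymptotics

namespace RumourSpreading

/-- `λ = max_{2 ≤ i ≤ n} |μ_i|`, where `μ_1 ≥ ... ≥ μ_n` are the eigenvalues of the adjacency matrix
(the index `0` of the antitone family `eigenvalues₀` is `μ_1`; the value is `0` if `n ≤ 1`). -/
noncomputable def secondEigenvalue {n : ℕ} (G : SimpleGraph (Fin n)) [DecidableRel G.Adj] : ℝ :=
  ⨆ i : {i : Fin (Fintype.card (Fin n)) // (i : ℕ) ≠ 0},
    |(G.isHermitian_adjMatrix ℝ).eigenvalues₀ i|

/-- Expander sequences: `G n` is a connected graph on `n` vertices (for `n ≥ 1`), and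
`Δ_n / δ_n = 1 + o(1)`, `λ_n = o(Δ_n)`. -/
structure IsExpanderSequence (G : (n : ℕ) → SimpleGraph (Fin n))
    [∀ n, DecidableRel (G n).Adj] : Prop where
  connected : ∀ n, 1 ≤ n → (G n).Connected
  degree_ratio : Tendsto (fun n => ((G n).maxDegree : ℝ) / ((G n).minDegree : ℝ)) atTop (𝓝 1)
  eigenvalue_isLittleO :
    (fun n => secondEigenvalue (G n)) =o[atTop] (fun n => ((G n).maxDegree : ℝ))

/-- `H` arises from `G` by deleting edges such that every vertex keeps at least a fraction `c`
of its edges. -/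
structure IsDeletion {n : ℕ} (c : ℝ) (G H : SimpleGraph (Fin n))
    [DecidableRel G.Adj] [DecidableRel H.Adj] : Prop where
  le : H ≤ G
  degree_le : ∀ v, c * (G.degree v : ℝ) ≤ (H.degree v : ℝ)

/-- The law of the vertex called by `v`: a uniformly random neighbour of `v`
(an isolated vertex calls itself, which has no effect). -/
noncomputable def contactLaw {n : ℕ} (G : SimpleGraph (Fin n)) [DecidableRel G.Adj]
    (v : Fin n) : PMF (Fin n) :=
  if h : (G.neighborFinset v).Nonempty then PMF.uniformOfFinset (G.neighborFinset v) h
  else PMF.pure v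

/-- The calls of one round: the vertex `v` calls `(c v).1`, and the transmission over this call
succeeds iff `(c v).2 = true`. -/
abbrev Calls (n : ℕ) : Type := Fin n → Fin n × Bool

/-- The law of the calls of one round: independently over the vertices `v`, the called vertex is a
uniformly random neighbour, and, independently of it, the transmission succeeds with
probability `q`. -/
noncomputable def roundLaw {n : ℕ} (G : SimpleGraph (Fin n)) [DecidableRel G.Adj]
    (q : unitInterval) : Measure (Calls n) :=
  Measure.pi fun v =>
    (contactLaw G v).toMeasure.prod (ProbabilityTheory.bernoulliMeasure true false q)

instance {n : ℕ} (G : SimpleGraph (Fin n)) [DecidableRel G.Adj] (q : unitInterval) :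
    IsProbabilityMeasure (roundLaw G q) := by
  unfold roundLaw
  infer_instance

/-- The law of the calls of all rounds, which are independent and identically distributed. -/
noncomputable def callsLaw {n : ℕ} (G : SimpleGraph (Fin n)) [DecidableRel G.Adj]
    (q : unitInterval) : Measure (ℕ → Calls n) :=
  Measure.infinitePi fun _ => roundLaw G q

instance {n : ℕ} (G : SimpleGraph (Fin n)) [DecidableRel G.Adj] (q : unitInterval) :
    IsProbabilityMeasure (callsLaw G q) := by
  unfold callsLaw
  infer_instance

/-- One round of push: every informed vertex informs the vertex it calls,
if the transmission succeeds. -/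
def pushStep {n : ℕ} (I : Finset (Fin n)) (c : Calls n) : Finset (Fin n) :=
  I ∪ Finset.univ.filter fun w => ∃ u ∈ I, c u = (w, true)

/-- One round of push&pull: whenever `u` calls `w`, the transmission succeeds, and one of
`u`, `w` is informed, both become informed. -/
def pushPullStep {n : ℕ} (I : Finset (Fin n)) (c : Calls n) : Finset (Fin n) :=
  I ∪ Finset.univ.filter fun w => (∃ u ∈ I, c u = (w, true)) ∨ (∃ u ∈ I, c w = (u, true))

/-- The set of informed vertices after `t` rounds of the protocol with one-round rule `step`,
if initially exactly `v` is informed. -/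
def informed {n : ℕ} (step : Finset (Fin n) → Calls n → Finset (Fin n)) (v : Fin n)
    (ω : ℕ → Calls n) : ℕ → Finset (Fin n)
  | 0 => {v}
  | t + 1 => step (informed step v ω t) (ω t)

/-- The number of rounds needed to inform at least `n - n / log n` vertices
(`⊤` if this never happens). -/
noncomputable def almostAllTime {n : ℕ} (step : Finset (Fin n) → Calls n → Finset (Fin n))
    (v : Fin n) (ω : ℕ → Calls n) : ℕ∞ :=
  ⨅ (t : ℕ) (_ : (n : ℝ) - n / Real.log n ≤ ((informed step v ω t).card : ℝ)), (t : ℕ∞)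

end RumourSpreading

namespace RumourSpreading

/-! The informed sets form a Markov chain, studied through its one-round operator `transition`. Fix
a weight `φ`; let `x` be the weight of the informed set and `m` the expected weight gained in a
round. Distinct uninformed vertices become informed with nonpositive correlation
(`informProb_pair_le`), so the gain has variance at most `max φ * m`. Hence the expected reciprocal
weight after the round is `1 / (x + m)` up to a relative error of order `max φ / x`
(`transition_inv_sum_le`). If `m ≥ γ x` as long as at most `θ n` vertices are informed, the
reciprocal weight shrinks by almost `1 + γ` per round, and Markov's inequality yields linear size
after `log_{1+γ} n + o(log n)` rounds. The other stretches, from one vertex to a large constant,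
from `θ n` to `n / 2`, and from there to `n - n / log n`, only need every cut to be crossed at a
positive rate; each fits into `κ log n` rounds for every `κ > 0`. All stretches are joined in
`exists_time_failProb_almostAll_le`.

Cuts survive the deletion (`eventually_cut`): by expander mixing, a set of at most `n / 2` vertices
has at most about half of its total degree in `G` inside itself, while a fraction `1/2 + ε` of the
edges is kept at each vertex.

Push: `φ = 1` and `γ = q`. By mixing, calls into a small informed set and multiple calls to the same
vertex are negligible (`eventually_push_growth`). Conversely the expected number of informed
vertices grows by at most `1 + q` per round, which gives the lower bound.

Push&pull: here `γ = 2q`, but cardinality is the wrong weight, since the degrees in `H` may vary and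
a vertex is then not necessarily pulled from at total rate `q`. The symmetric nonnegative rate
matrix `M` has Rayleigh quotient `2` at the constant vector, so the modulus of an eigenvector gives
`φ ≥ 0` with `M φ ≥ 2 φ`. By symmetry the expected gain of a small set `J` is nearly `q ∑_{u ∈ J} (M
φ) u ≥ 2q ∑_{u ∈ J} φ u`. Density and cuts allow `φ` to be bounded between positive constants
(`exists_weight`), so weight and cardinality are comparable. -/

/-- One round of push (`pull = false`) or of push&pull (`pull = true`). -/
def protocolStep {n : ℕ} (pull : Bool) (I : Finset (Fin n)) (c : Calls n) : Finset (Fin n) :=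
  I ∪ Finset.univ.filter fun w =>
    (∃ u ∈ I, c u = (w, true)) ∨ (pull = true ∧ ∃ u ∈ I, c w = (u, true))

lemma pushStep_eq {n : ℕ} : (pushStep : Finset (Fin n) → Calls n → _) = protocolStep false := by
  funext I c; simp [pushStep, protocolStep]

lemma pushPullStep_eq {n : ℕ} :
    (pushPullStep : Finset (Fin n) → Calls n → _) = protocolStep true := by
  funext I c; simp [pushPullStep, protocolStep]

lemma subset_protocolStep {n : ℕ} (pull : Bool) (I : Finset (Fin n)) (c : Calls n) :
    I ⊆ protocolStep pull I c := Finset.subset_union_left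

lemma informed_mono {n : ℕ} (pull : Bool) (v : Fin n) (ω : ℕ → Calls n) :
    Monotone (informed (protocolStep pull) v ω) :=
  monotone_nat_of_le_succ fun _ => subset_protocolStep _ _ _

lemma informed_congr {n : ℕ} (step : Finset (Fin n) → Calls n → Finset (Fin n)) (v : Fin n)
    {ω ω' : ℕ → Calls n} {t : ℕ} (h : ∀ i < t, ω i = ω' i) :
    informed step v ω t = informed step v ω' t := by
  induction t with
  | zero => rfl
  | succ t ih =>
    rw [informed, informed, ih fun i hi => h i (hi.trans t.lt_succ_self), h t t.lt_succ_self]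

/-! ### The Markov chain of informed sets and its transition operator -/

section Transition

variable {n : ℕ} (G : SimpleGraph (Fin n)) [DecidableRel G.Adj] (q : unitInterval) (pull : Bool)

/-- The transition operator of the Markov chain of informed sets. -/
noncomputable def transition (f : Finset (Fin n) → ℝ) (I : Finset (Fin n)) : ℝ :=
  ∫ c, f (protocolStep pull I c) ∂(roundLaw G q)

/-- The set after `t` rounds depends only on the first `t` coordinates, which are independent of the
next one; Fubini integrates out the last round. -/
lemma integral_informed (v : Fin n) (t : ℕ) (f : Finset (Fin n) → ℝ) :
    ∫ ω, f (informed (protocolStep pull) v ω t) ∂(callsLaw G q) =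
      ((transition G q pull)^[t] f) {v} := by
  induction t generalizing f with
  | zero => simp [informed]
  | succ t ih =>
    rw [Function.iterate_succ_apply, ← ih]
    have hind := ProbabilityTheory.iIndepFun_infinitePi
      (P := fun _ : ℕ => roundLaw G q) (X := fun _ c => c) (fun _ => measurable_id)
    have h2 := hind.indepFun_finset (Finset.range t) {t} (by simp)
      (fun i => measurable_pi_apply i)
    have h3 : ProbabilityTheory.IndepFun (fun (ω : ℕ → Calls n) (i : Finset.range t) => ω i)
        (fun ω => ω t) (callsLaw G q) :=
      h2.comp (φ := id) (ψ := fun x : ({t} : Finset ℕ) → Calls n => x ⟨t, by simp⟩)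
        measurable_id (measurable_pi_apply _)
    have hm : Measurable (fun (ω : ℕ → Calls n) (i : Finset.range t) => ω i) :=
      measurable_pi_lambda _ fun i => measurable_pi_apply _
    have hmap := (ProbabilityTheory.indepFun_iff_map_prod_eq_prod_map_map
      hm.aemeasurable (measurable_pi_apply t).aemeasurable).1 h3
    have hlast : (callsLaw G q).map (fun ω => ω t) = roundLaw G q :=
      Measure.infinitePi_map_eval _ t
    rw [hlast] at hmap
    -- The padding from round `t` on is never read. It factors the informed set through a finite
    -- product, where measurability and integrability are automatic.
    let ext : ((Finset.range t) → Calls n) → ℕ → Calls n := fun x i =>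
      if h : i ∈ Finset.range t then x ⟨i, h⟩ else fun v => (v, false)
    have hext : ∀ ω : ℕ → Calls n, informed (protocolStep pull) v ω t =
        informed (protocolStep pull) v (ext fun i => ω i) t := fun ω =>
      informed_congr _ _ fun i hi => by simp [ext, hi]
    let F : ((Finset.range t) → Calls n) × Calls n → ℝ := fun p =>
      f (protocolStep pull (informed (protocolStep pull) v (ext p.1) t) p.2)
    have hF : ∀ ω : ℕ → Calls n, f (informed (protocolStep pull) v ω (t + 1)) =
        F ((fun i : Finset.range t => ω i), ω t) := fun ω => by
      simp only [informed, F]; rw [hext ω]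
    have hprob : IsProbabilityMeasure
        ((callsLaw G q).map fun (ω : ℕ → Calls n) (i : Finset.range t) => ω i) :=
      Measure.isProbabilityMeasure_map hm.aemeasurable
    rw [integral_congr_ae (ae_of_all _ hF), ← integral_map (f := F)
      (hm.prodMk (measurable_pi_apply t)).aemeasurable (measurable_of_finite _).aestronglyMeasurable,
      hmap, integral_prod _ .of_finite,
      integral_map hm.aemeasurable (measurable_of_finite _).aestronglyMeasurable]
    refine integral_congr_ae (ae_of_all _ fun ω => ?_)
    simp only [transition, F]
    rw [hext ω]

variable {G q pull}

lemma transition_mono {f g : Finset (Fin n) → ℝ} {I : Finset (Fin n)}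
    (h : ∀ J, I ⊆ J → f J ≤ g J) : transition G q pull f I ≤ transition G q pull g I :=
  integral_mono .of_finite .of_finite fun c => h _ (subset_protocolStep pull I c)

lemma transition_const_mul (a : ℝ) (f : Finset (Fin n) → ℝ) :
    transition G q pull (fun J => a * f J) = fun I => a * transition G q pull f I := by
  funext I; exact integral_const_mul _ _

lemma transition_const_add (a : ℝ) (f : Finset (Fin n) → ℝ) :
    transition G q pull (fun J => a + f J) = fun I => a + transition G q pull f I := by
  funext I
  unfold transition
  rw [integral_add .of_finite .of_finite]
  simp

lemma iterate_transition_mono {f g : Finset (Fin n) → ℝ} (t : ℕ) {I : Finset (Fin n)}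
    (h : ∀ J, I ⊆ J → f J ≤ g J) :
    (transition G q pull)^[t] f I ≤ (transition G q pull)^[t] g I := by
  induction t generalizing I with
  | zero => exact h _ subset_rfl
  | succ t ih =>
    rw [Function.iterate_succ_apply', Function.iterate_succ_apply']
    exact transition_mono fun J hJ => ih fun K hK => h K (hJ.trans hK)

lemma iterate_transition_const_add (a : ℝ) (f : Finset (Fin n) → ℝ) (t : ℕ) :
    (transition G q pull)^[t] (fun J => a + f J) =
      fun I => a + (transition G q pull)^[t] f I := by
  induction t with
  | zero => rfl
  | succ t ih =>
    rw [Function.iterate_succ_apply', ih, transition_const_add]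
    simp_rw [Function.iterate_succ_apply']

lemma iterate_transition_const_mul (a : ℝ) (f : Finset (Fin n) → ℝ) (t : ℕ) :
    (transition G q pull)^[t] (fun J => a * f J) =
      fun I => a * (transition G q pull)^[t] f I := by
  induction t with
  | zero => rfl
  | succ t ih =>
    rw [Function.iterate_succ_apply', ih, transition_const_mul]
    simp_rw [Function.iterate_succ_apply']

/-- If the transition operator contracts `h` by a factor `ρ` above `I`, then `t` rounds contract it
by `ρ ^ t`. -/
lemma iterate_transition_le {h : Finset (Fin n) → ℝ} {ρ : ℝ} (hρ : 0 ≤ ρ)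
    {I : Finset (Fin n)} (H : ∀ J, I ⊆ J → transition G q pull h J ≤ ρ * h J) (t : ℕ) :
    (transition G q pull)^[t] h I ≤ ρ ^ t * h I := by
  suffices ∀ J, I ⊆ J → (transition G q pull)^[t] h J ≤ ρ ^ t * h J from this I subset_rfl
  induction t with
  | zero => simp
  | succ t ih =>
    intro J hJ
    rw [Function.iterate_succ_apply']
    calc _ ≤ transition G q pull (fun K => ρ ^ t * h K) J :=
          transition_mono fun K hK => ih K (hJ.trans hK)
      _ = ρ ^ t * transition G q pull h J := by rw [transition_const_mul]
      _ ≤ ρ ^ t * (ρ * h J) := by gcongr; exact H J hJ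
      _ = _ := by ring

/-- The probability that `A` fails after `t` rounds started from `I`. -/
noncomputable def failProb (G : SimpleGraph (Fin n)) [DecidableRel G.Adj] (q : unitInterval)
    (pull : Bool) (A : Set (Finset (Fin n))) (t : ℕ) : Finset (Fin n) → ℝ :=
  (transition G q pull)^[t] (Aᶜ.indicator 1)

lemma failProb_le_one (A : Set (Finset (Fin n))) (t : ℕ) (I : Finset (Fin n)) :
    failProb G q pull A t I ≤ 1 := by
  -- The constant `1` is written as `1 + 0 * 0`, so that the two rules for constants evaluate its
  -- iterates.
  have h0 := iterate_transition_const_add (G := G) (q := q) (pull := pull) 1 (fun _ => 0 * 0) t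
  rw [iterate_transition_const_mul] at h0
  have := iterate_transition_mono (G := G) (q := q) (pull := pull)
    (f := Aᶜ.indicator 1) (g := fun _ => 1 + 0 * 0) t (I := I) fun J _ => by
      by_cases h : J ∈ Aᶜ <;> simp [h]
  rw [h0] at this
  simpa [failProb] using this

/-- Markov property: failure of `B` after `s + t` rounds is charged either to failure of `A` after
`s` rounds, or to the `t` rounds restarted from a set in `A`. -/
lemma failProb_add_le {A B : Set (Finset (Fin n))} {s t : ℕ} {I : Finset (Fin n)} {a b : ℝ}
    (hb : 0 ≤ b) (hA : failProb G q pull A s I ≤ a)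
    (hB : ∀ J ∈ A, failProb G q pull B t J ≤ b) : failProb G q pull B (s + t) I ≤ a + b := by
  rw [failProb, Function.iterate_add_apply]
  calc _ ≤ (transition G q pull)^[s] (fun J => b + Aᶜ.indicator 1 J) I := by
        refine iterate_transition_mono s fun J _ => ?_
        by_cases h : J ∈ A
        · simpa [h, failProb] using hB J h
        · have := failProb_le_one (G := G) (q := q) (pull := pull) B t J
          simp only [failProb] at this
          simp [h]; linarith
    _ = b + failProb G q pull A s I := by rw [iterate_transition_const_add]; rfl
    _ ≤ _ := by linarith

/-- Markov's inequality for a contracted function `h`. -/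
lemma failProb_le_of_contract {A : Set (Finset (Fin n))} {h : Finset (Fin n) → ℝ} {ρ x : ℝ}
    {I : Finset (Fin n)} (hρ : 0 ≤ ρ) (hx : 0 ≤ x) (h0 : ∀ J, 0 ≤ h J)
    (hA : ∀ J K, J ∈ A → J ⊆ K → K ∈ A) (hbad : ∀ J, I ⊆ J → J ∉ A → 1 ≤ x * h J)
    (H : ∀ J, I ⊆ J → J ∉ A → transition G q pull h J ≤ ρ * h J) (t : ℕ) :
    failProb G q pull A t I ≤ x * (ρ ^ t * h I) := by
  classical
  -- Since `A` is absorbing, `h` cut off to `0` on `A` is contracted everywhere above `I`, although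
  -- `h` itself is only contracted outside `A`.
  have key := iterate_transition_le (G := G) (q := q) (pull := pull) (h := Aᶜ.indicator h) hρ
    (I := I) (fun J hJ => by
      by_cases hJA : J ∈ A
      · have : transition G q pull (Aᶜ.indicator h) J = 0 := by
          unfold transition
          refine integral_eq_zero_of_ae (ae_of_all _ fun c => ?_)
          simp [hA _ _ hJA (subset_protocolStep pull J c)]
        simp [this, hJA]
      · have e : Aᶜ.indicator h J = h J := by simp [hJA]
        rw [e]
        refine (transition_mono fun K _ => ?_).trans (H J hJ hJA)
        exact Set.indicator_le_self' (fun _ _ => h0 _) _) t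
  calc failProb G q pull A t I ≤ (transition G q pull)^[t] (fun J => x * Aᶜ.indicator h J) I := by
        refine iterate_transition_mono t fun J hJ => ?_
        by_cases hJA : J ∈ A
        · simp [hJA]
        · simpa [hJA] using hbad J hJ hJA
    _ = x * (transition G q pull)^[t] (Aᶜ.indicator h) I := by rw [iterate_transition_const_mul]
    _ ≤ x * (ρ ^ t * Aᶜ.indicator h I) := by gcongr
    _ ≤ _ := by
      gcongr
      exact Set.indicator_le_self' (fun _ _ => h0 _) _

lemma measurable_informed (v : Fin n) (t : ℕ) (A : Set (Finset (Fin n))) :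
    MeasurableSet {ω : ℕ → Calls n | informed (protocolStep pull) v ω t ∈ A} := by
  let ext : ((Finset.range t) → Calls n) → ℕ → Calls n := fun x i =>
    if h : i ∈ Finset.range t then x ⟨i, h⟩ else fun v => (v, false)
  have hm : Measurable (fun (ω : ℕ → Calls n) (i : Finset.range t) => ω i) :=
    measurable_pi_lambda _ fun i => measurable_pi_apply _
  have : {ω : ℕ → Calls n | informed (protocolStep pull) v ω t ∈ A} =
      (fun (ω : ℕ → Calls n) (i : Finset.range t) => ω i) ⁻¹'
        {x | informed (protocolStep pull) v (ext x) t ∈ A} := by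
    ext ω
    simp only [Set.mem_ofPred_eq, Set.mem_preimage]
    rw [informed_congr (ω := ω) (ω' := ext fun i => ω i) _ _ fun i hi => by simp [ext, hi]]
  rw [this]
  exact hm (Set.toFinite _).measurableSet

lemma measureReal_informed_notMem (v : Fin n) (t : ℕ) (A : Set (Finset (Fin n))) :
    (callsLaw G q).real {ω | informed (protocolStep pull) v ω t ∉ A} =
      failProb G q pull A t {v} := by
  rw [failProb, ← integral_informed, ← integral_indicator_one]
  · rfl
  · exact measurable_informed v t Aᶜ

end Transition

/-! ### One round: inform probabilities, negative correlation, reciprocal weight -/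

section Round

variable {n : ℕ} (G : SimpleGraph (Fin n)) [DecidableRel G.Adj] (q : unitInterval)

/-- The law of the call of the vertex `v`. -/
noncomputable def callLaw (v : Fin n) : Measure (Fin n × Bool) :=
  (contactLaw G v).toMeasure.prod (ProbabilityTheory.bernoulliMeasure true false q)

instance (v : Fin n) : IsProbabilityMeasure (callLaw G q v) := by
  unfold callLaw; infer_instance

/-- The probability that `u` successfully calls `w`. -/
noncomputable def callProb (u w : Fin n) : ℝ := (callLaw G q u).real {(w, true)}

lemma callProb_nonneg (u w : Fin n) : 0 ≤ callProb G q u w := measureReal_nonneg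

variable {G} in
lemma callProb_eq {u : Fin n} (hu : 0 < G.degree u) (w : Fin n) :
    callProb G q u w = if G.Adj u w then (q : ℝ) / G.degree u else 0 := by
  have hne : (G.neighborFinset u).Nonempty := Finset.card_pos.1 hu
  have h1 : (ProbabilityTheory.bernoulliMeasure true false q).real {true} = q := by
    rw [ProbabilityTheory.bernoulliMeasure_real_apply] <;> simp
  rw [callProb, callLaw, ← Set.singleton_prod_singleton, measureReal_prod_prod, h1, measureReal_def,
    PMF.toMeasure_apply_singleton _ _ (measurableSet_singleton _), contactLaw, dif_pos hne,
    PMF.uniformOfFinset_apply]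
  simp only [SimpleGraph.mem_neighborFinset, SimpleGraph.card_neighborFinset_eq_degree]
  split_ifs
  · simp [div_eq_inv_mul]
  · simp

lemma sum_callProb_eq (u : Fin n) (S : Finset (Fin n)) :
    ∑ w ∈ S, callProb G q u w = (callLaw G q u).real {x | x.1 ∈ S ∧ x.2 = true} := by
  classical
  have : {x : Fin n × Bool | x.1 ∈ S ∧ x.2 = true} =
      ((S.image fun w => (w, true) : Finset (Fin n × Bool)) : Set (Fin n × Bool)) := by
    ext ⟨a, b⟩
    simp only [Set.mem_ofPred_eq, Finset.coe_image, Set.mem_image, Finset.mem_coe]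
    constructor
    · rintro ⟨h, rfl⟩
      exact ⟨a, h, rfl⟩
    · rintro ⟨w, h, heq⟩
      cases heq
      exact ⟨h, rfl⟩
  rw [this, ← sum_measureReal_singleton, Finset.sum_image (by simp)]
  rfl

/-- The calls of `v` that do not inform `w`, if `I` is the set of informed vertices. -/
def missing (pull : Bool) (I : Finset (Fin n)) (w v : Fin n) : Set (Fin n × Bool) :=
  if v ∈ I then {(w, true)}ᶜ
  else if v = w ∧ pull = true then {x | x.1 ∈ I ∧ x.2 = true}ᶜ else Set.univ

/-- Staying uninformed is a separate condition on the call of each vertex, so the event is a box and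
its probability factorizes. -/
lemma setOf_notMem_protocolStep {pull : Bool} {I : Finset (Fin n)} {w : Fin n} (hw : w ∉ I) :
    {c : Calls n | w ∉ protocolStep pull I c} = Set.pi Set.univ (missing pull I w) := by
  ext c
  simp only [protocolStep, Finset.mem_union, hw, false_or, Finset.mem_filter_univ, not_or,
    Set.mem_ofPred_eq, Set.mem_univ_pi, missing]
  constructor
  · rintro ⟨h1, h2⟩ v
    split_ifs with hv hv'
    · exact fun h => h1 ⟨v, hv, h⟩
    · rintro ⟨h3, h4⟩
      obtain ⟨rfl, hp⟩ := hv'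
      exact h2 ⟨hp, (c v).1, h3, Prod.ext rfl h4⟩
    · trivial
  · refine fun h => ⟨?_, ?_⟩
    · rintro ⟨u, hu, hc⟩
      have := h u
      simp [hu, hc] at this
    · rintro ⟨hp, u, hu, hc⟩
      have := h w
      simp [hw, hp, hc, hu] at this

lemma roundLaw_real_pi (B : Fin n → Set (Fin n × Bool)) :
    (roundLaw G q).real (Set.pi Set.univ B) = ∏ v, (callLaw G q v).real (B v) := by
  rw [roundLaw, measureReal_def, Measure.pi_pi, ENNReal.toReal_prod]
  rfl

/-- The rate at which the uninformed vertex `w` is informed. -/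
noncomputable def contactRate (pull : Bool) (I : Finset (Fin n)) (w : Fin n) : ℝ :=
  ∑ u ∈ I, callProb G q u w + if pull = true then ∑ u ∈ I, callProb G q w u else 0

lemma contactRate_nonneg (pull : Bool) (I : Finset (Fin n)) (w : Fin n) :
    0 ≤ contactRate G q pull I w := by
  unfold contactRate
  refine add_nonneg (Finset.sum_nonneg fun u _ => callProb_nonneg G q u w) ?_
  split_ifs
  · exact Finset.sum_nonneg fun u _ => callProb_nonneg G q w u
  · exact le_rfl

/-- The probability that `w` is informed after a round started from `I`. -/
noncomputable def informProb (pull : Bool) (I : Finset (Fin n)) (w : Fin n) : ℝ :=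
  (roundLaw G q).real {c | w ∈ protocolStep pull I c}

lemma informProb_nonneg (pull : Bool) (I : Finset (Fin n)) (w : Fin n) :
    0 ≤ informProb G q pull I w := measureReal_nonneg

lemma one_sub_informProb (pull : Bool) (I : Finset (Fin n)) (w : Fin n) :
    (roundLaw G q).real {c | w ∉ protocolStep pull I c} = 1 - informProb G q pull I w := by
  rw [informProb, ← probReal_compl_eq_one_sub (Set.toFinite _).measurableSet]
  rfl

/-- By independence, `w` stays uninformed with probability a product of factors `1 - r v ≤ exp (-r
v)`, hence at most `exp (-s) ≤ 1 / (1 + s)`. -/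
lemma le_informProb {pull : Bool} {I : Finset (Fin n)} {w : Fin n} (hw : w ∉ I) :
    contactRate G q pull I w / (1 + contactRate G q pull I w) ≤ informProb G q pull I w := by
  set s := contactRate G q pull I w with hs
  have hs0 : 0 ≤ s := contactRate_nonneg G q pull I w
  have key : 1 - informProb G q pull I w ≤ Real.exp (-s) := by
    rw [← one_sub_informProb, setOf_notMem_protocolStep hw, roundLaw_real_pi]
    let r : Fin n → ℝ := fun v => (if v ∈ I then callProb G q v w else 0) +
      (if v = w then (if pull = true then ∑ u ∈ I, callProb G q w u else 0) else 0)
    have hr : s = ∑ v, r v := by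
      simp [hs, r, contactRate, Finset.sum_add_distrib]
    rw [hr, ← Finset.sum_neg_distrib, Real.exp_sum]
    refine Finset.prod_le_prod (fun _ _ => measureReal_nonneg) fun v _ => ?_
    refine le_trans (le_of_eq ?_) (Real.one_sub_le_exp_neg (r v))
    simp only [missing, r]
    by_cases hv : v ∈ I
    · have hvw : v ≠ w := fun h => hw (h ▸ hv)
      simp only [hv, if_true, hvw, if_false, add_zero]
      rw [probReal_compl_eq_one_sub (measurableSet_singleton _)]
      rfl
    · by_cases hvw : v = w ∧ pull = true
      · obtain ⟨rfl, hp⟩ := hvw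
        simp only [hv, hp, if_true, if_false, and_self, zero_add]
        rw [probReal_compl_eq_one_sub (Set.toFinite _).measurableSet, sum_callProb_eq]
      · simp only [hv, hvw, if_false, zero_add]
        by_cases h : v = w
        · have : pull ≠ true := fun hp => hvw ⟨h, hp⟩
          simp [this]
        · simp [h]
  have h2 : Real.exp (-s) ≤ 1 / (1 + s) := by
    rw [Real.exp_neg, ← one_div]
    exact one_div_le_one_div_of_le (by linarith) (by linarith [Real.add_one_le_exp s])
  have h3 : s / (1 + s) = 1 - 1 / (1 + s) := by field_simp; ring
  rw [h3]; linarith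

lemma informProb_push_le {I : Finset (Fin n)} {w : Fin n} (hw : w ∉ I) :
    informProb G q false I w ≤ ∑ u ∈ I, callProb G q u w := by
  have : {c : Calls n | w ∈ protocolStep false I c} ⊆ ⋃ u ∈ I, {c : Calls n | c u = (w, true)} := by
    intro c hc
    simpa [protocolStep, hw] using hc
  refine (measureReal_mono this (measure_ne_top _ _)).trans
    ((measureReal_biUnion_finset_le _ _).trans (Finset.sum_le_sum fun u _ => le_of_eq ?_))
  have := (measurePreserving_eval (fun v => callLaw G q v) u).measureReal_preimage
    (measurableSet_singleton (w, true)).nullMeasurableSet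
  exact this

lemma informProb_push_le_pushPull (I : Finset (Fin n)) (w : Fin n) :
    informProb G q false I w ≤ informProb G q true I w := by
  refine measureReal_mono (fun c hc => ?_) (measure_ne_top _ _)
  simp only [protocolStep, Set.mem_ofPred_eq, Finset.mem_union, Finset.mem_filter_univ] at hc ⊢
  rcases hc with h | h | ⟨h, _⟩
  · exact Or.inl h
  · exact Or.inr (Or.inl h)
  · exact absurd h (by simp)

/-- The events that two uninformed vertices become informed are negatively correlated. -/
lemma informProb_pair_le {pull : Bool} {I : Finset (Fin n)} {w w' : Fin n} (hw : w ∉ I)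
    (hw' : w' ∉ I) (hne : w ≠ w') :
    (roundLaw G q).real {c | w ∈ protocolStep pull I c ∧ w' ∈ protocolStep pull I c} ≤
      informProb G q pull I w * informProb G q pull I w' := by
  have key : (roundLaw G q).real
      {c | w ∉ protocolStep pull I c ∧ w' ∉ protocolStep pull I c} ≤
      (1 - informProb G q pull I w) * (1 - informProb G q pull I w') := by
    have e : {c : Calls n | w ∉ protocolStep pull I c ∧ w' ∉ protocolStep pull I c} =
        Set.pi Set.univ fun v => missing pull I w v ∩ missing pull I w' v := by
      rw [Set.pi_inter_distrib, ← setOf_notMem_protocolStep hw, ← setOf_notMem_protocolStep hw']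
      rfl
    rw [← one_sub_informProb, ← one_sub_informProb, e, setOf_notMem_protocolStep hw,
      setOf_notMem_protocolStep hw', roundLaw_real_pi, roundLaw_real_pi, roundLaw_real_pi,
      ← Finset.prod_mul_distrib]
    -- Factor by factor: an informed `v` makes one call and cannot reach both vertices, so `1 - p -
    -- p' ≤ (1 - p) * (1 - p')`; the call of an uninformed `v` matters for at most one of `w`, `w'`.
    refine Finset.prod_le_prod (fun _ _ => measureReal_nonneg) fun v _ => ?_
    by_cases hv : v ∈ I
    · simp only [missing, hv, if_true]
      rw [← Set.compl_union, probReal_compl_eq_one_sub (Set.toFinite _).measurableSet,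
        probReal_compl_eq_one_sub (Set.toFinite _).measurableSet,
        probReal_compl_eq_one_sub (Set.toFinite _).measurableSet,
        measureReal_union (by simpa using hne) (Set.toFinite _).measurableSet]
      have h1 := callProb_nonneg G q v w
      have h2 := callProb_nonneg G q v w'
      simp only [callProb] at h1 h2
      nlinarith
    · by_cases h : v = w
      · have h' : v ≠ w' := fun h' => hne (h.symm.trans h')
        simp [missing, hv, h']
      · simp [missing, hv, h]
  have e1 : (roundLaw G q).real
      {c | w ∉ protocolStep pull I c ∧ w' ∉ protocolStep pull I c} =
      1 - (roundLaw G q).real {c | w ∈ protocolStep pull I c ∨ w' ∈ protocolStep pull I c} := by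
    rw [← probReal_compl_eq_one_sub (Set.toFinite _).measurableSet]
    congr 1
    ext c; simp
  have e2 := measureReal_union_add_inter (μ := roundLaw G q)
    (s := {c | w ∈ protocolStep pull I c}) (t := {c | w' ∈ protocolStep pull I c})
    (Set.toFinite _).measurableSet
  change (roundLaw G q).real {c | w ∈ protocolStep pull I c ∨ w' ∈ protocolStep pull I c} +
    (roundLaw G q).real {c | w ∈ protocolStep pull I c ∧ w' ∈ protocolStep pull I c} =
    informProb G q pull I w + informProb G q pull I w' at e2
  nlinarith

/-- The expected weight of the vertices that are informed in one round started from `I`. -/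
noncomputable def expectedGain (pull : Bool) (φ : Fin n → ℝ) (I : Finset (Fin n)) : ℝ :=
  ∑ w ∈ Iᶜ, φ w * informProb G q pull I w

variable {G q} {pull : Bool} {φ : Fin n → ℝ} {I : Finset (Fin n)}

open Classical in
lemma sum_protocolStep (c : Calls n) :
    ∑ w ∈ protocolStep pull I c, φ w =
      ∑ w ∈ I, φ w + ∑ w ∈ Iᶜ, φ w * {c | w ∈ protocolStep pull I c}.indicator 1 c := by
  rw [← Finset.sum_sdiff (subset_protocolStep pull I c), add_comm]
  congr 1
  rw [← Finset.sum_filter_add_sum_filter_not Iᶜ (· ∈ protocolStep pull I c)]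
  rw [Finset.sum_eq_zero (s := Iᶜ.filter (· ∉ protocolStep pull I c)), add_zero]
  · refine Finset.sum_congr (by ext; simp [and_comm]) fun w hw => ?_
    simp only [Finset.mem_filter] at hw
    simp [Set.indicator, hw.2]
  · intro w hw
    simp only [Finset.mem_filter] at hw
    simp [Set.indicator, hw.2]

lemma integral_indicator_inform (w : Fin n) :
    ∫ c, {c | w ∈ protocolStep pull I c}.indicator (1 : Calls n → ℝ) c ∂(roundLaw G q) =
      informProb G q pull I w :=
  integral_indicator_one (Set.toFinite _).measurableSet

lemma integral_gain :
    ∫ c, ∑ w ∈ Iᶜ, φ w * {c | w ∈ protocolStep pull I c}.indicator (1 : Calls n → ℝ) c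
      ∂(roundLaw G q) = expectedGain G q pull φ I := by
  rw [integral_finsetSum _ fun _ _ => .of_finite]
  simp_rw [integral_const_mul, integral_indicator_inform]
  rfl

lemma transition_sum :
    transition G q pull (fun J => ∑ w ∈ J, φ w) I = ∑ w ∈ I, φ w + expectedGain G q pull φ I := by
  unfold transition
  simp_rw [sum_protocolStep]
  rw [integral_add .of_finite .of_finite, integral_gain]
  simp

/-- The variance of the gain is at most `b` times its mean: diagonal terms use `φ w ^ 2 ≤ b * φ w`,
off-diagonal ones the negative correlation. -/
lemma integral_gain_sq_le {b : ℝ} (h0 : ∀ w, 0 ≤ φ w) (hb : ∀ w, φ w ≤ b) :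
    ∫ c, (∑ w ∈ Iᶜ, φ w * {c | w ∈ protocolStep pull I c}.indicator (1 : Calls n → ℝ) c) ^ 2
      ∂(roundLaw G q) ≤ b * expectedGain G q pull φ I + expectedGain G q pull φ I ^ 2 := by
  have e : ∀ c : Calls n,
      (∑ w ∈ Iᶜ, φ w * {c | w ∈ protocolStep pull I c}.indicator (1 : Calls n → ℝ) c) ^ 2 =
      ∑ w ∈ Iᶜ, ∑ w' ∈ Iᶜ, φ w * φ w' *
        {c | w ∈ protocolStep pull I c ∧ w' ∈ protocolStep pull I c}.indicator 1 c := by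
    intro c
    rw [sq, Finset.sum_mul_sum]
    refine Finset.sum_congr rfl fun w _ => Finset.sum_congr rfl fun w' _ => ?_
    by_cases h1 : w ∈ protocolStep pull I c <;> by_cases h2 : w' ∈ protocolStep pull I c <;>
      simp [Set.indicator, h1, h2]
  simp_rw [e]
  rw [integral_finsetSum _ fun _ _ => .of_finite]
  have hin : ∀ w ∈ Iᶜ, ∫ c, ∑ w' ∈ Iᶜ, φ w * φ w' *
        {c | w ∈ protocolStep pull I c ∧ w' ∈ protocolStep pull I c}.indicator (1 : Calls n → ℝ) c
        ∂(roundLaw G q) ≤ b * (φ w * informProb G q pull I w) +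
        φ w * informProb G q pull I w * expectedGain G q pull φ I := by
    intro w hw
    rw [integral_finsetSum _ fun _ _ => .of_finite]
    have hterm : ∀ w' ∈ Iᶜ, ∫ c, φ w * φ w' *
        {c | w ∈ protocolStep pull I c ∧ w' ∈ protocolStep pull I c}.indicator (1 : Calls n → ℝ) c
        ∂(roundLaw G q) ≤ (if w' = w then b * (φ w * informProb G q pull I w) else 0) +
          φ w * informProb G q pull I w * (φ w' * informProb G q pull I w') := by
      intro w' hw'
      rw [integral_const_mul, integral_indicator_one (Set.toFinite _).measurableSet]
      have hp := informProb_nonneg G q pull I w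
      have hp' := informProb_nonneg G q pull I w'
      split_ifs with h
      · subst h
        simp only [and_self]
        change φ w' * φ w' * informProb G q pull I w' ≤ _
        have := mul_le_mul_of_nonneg_right (hb w') (mul_nonneg (h0 w') hp)
        have := mul_nonneg (mul_nonneg (h0 w') hp) (mul_nonneg (h0 w') hp)
        linarith
      · have := informProb_pair_le G q (pull := pull) (Finset.mem_compl.1 hw)
          (Finset.mem_compl.1 hw') (Ne.symm h)
        calc _ ≤ φ w * φ w' * (informProb G q pull I w * informProb G q pull I w') :=
              mul_le_mul_of_nonneg_left this (mul_nonneg (h0 w) (h0 w'))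
          _ = _ := by ring
    refine (Finset.sum_le_sum hterm).trans (le_of_eq ?_)
    rw [Finset.sum_add_distrib, Finset.sum_ite_eq' , if_pos hw, ← Finset.mul_sum]
    rfl
  refine (Finset.sum_le_sum hin).trans (le_of_eq ?_)
  rw [Finset.sum_add_distrib, ← Finset.mul_sum, ← Finset.sum_mul, sq]
  rfl

lemma expectedGain_nonneg (h0 : ∀ w, 0 ≤ φ w) : 0 ≤ expectedGain G q pull φ I :=
  Finset.sum_nonneg fun w _ => mul_nonneg (h0 w) (informProb_nonneg _ _ _ _ _)

/-- The reciprocal of the weight of the informed set is contracted. -/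
lemma transition_inv_sum_le {b : ℝ} (h0 : ∀ w, 0 ≤ φ w) (hb : ∀ w, φ w ≤ b)
    (hI : 0 < ∑ w ∈ I, φ w) :
    transition G q pull (fun J => (∑ w ∈ J, φ w)⁻¹) I ≤
      ((∑ w ∈ I, φ w) / (∑ w ∈ I, φ w + expectedGain G q pull φ I) +
        b * expectedGain G q pull φ I / (∑ w ∈ I, φ w + expectedGain G q pull φ I) ^ 2) *
        (∑ w ∈ I, φ w)⁻¹ := by
  set x := ∑ w ∈ I, φ w with hx
  set m := expectedGain G q pull φ I with hm
  have hm0 : 0 ≤ m := expectedGain_nonneg h0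
  set Z : Calls n → ℝ := fun c =>
    ∑ w ∈ Iᶜ, φ w * {c | w ∈ protocolStep pull I c}.indicator (1 : Calls n → ℝ) c with hZ
  have hZ0 : ∀ c, 0 ≤ Z c := fun c => Finset.sum_nonneg fun w _ =>
    mul_nonneg (h0 w) (Set.indicator_nonneg (fun _ _ => zero_le_one) _)
  have hEZ : ∫ c, Z c ∂(roundLaw G q) = m := integral_gain
  have hEZ2 : ∫ c, Z c ^ 2 ∂(roundLaw G q) ≤ b * m + m ^ 2 := integral_gain_sq_le h0 hb
  have ha : 0 < x + m := by linarith
  have hpt : ∀ c, (∑ w ∈ protocolStep pull I c, φ w)⁻¹ ≤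
      (x + m)⁻¹ + ((m * (x + m)⁻¹ ^ 2) + m ^ 2 * ((x + m)⁻¹ ^ 2 * x⁻¹)) +
      (-((x + m)⁻¹ ^ 2) - 2 * m * ((x + m)⁻¹ ^ 2 * x⁻¹)) * Z c +
      ((x + m)⁻¹ ^ 2 * x⁻¹) * Z c ^ 2 := by
    intro c
    rw [sum_protocolStep, ← hx]
    change (x + Z c)⁻¹ ≤ _
    have hxz : 0 < x + Z c := by linarith [hZ0 c]
    -- Exact second-order expansion about the mean `x + m`. The linear term integrates to `0`, and
    -- bounding the last factor by `x⁻¹` leaves only the variance of `Z`.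
    have e : (x + Z c)⁻¹ = (x + m)⁻¹ - (Z c - m) * (x + m)⁻¹ ^ 2 +
        (Z c - m) ^ 2 * (x + m)⁻¹ ^ 2 * (x + Z c)⁻¹ := by
      field_simp; ring
    have h2 : (x + Z c)⁻¹ ≤ x⁻¹ := inv_anti₀ hI (by linarith [hZ0 c])
    have h3 : (Z c - m) ^ 2 * (x + m)⁻¹ ^ 2 * (x + Z c)⁻¹ ≤
      (Z c - m) ^ 2 * (x + m)⁻¹ ^ 2 * x⁻¹ := by gcongr
    rw [e]
    linarith
  have hint := integral_mono (μ := roundLaw G q) .of_finite .of_finite hpt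
  rw [integral_add .of_finite .of_finite, integral_add .of_finite .of_finite, integral_const_mul,
    integral_const_mul, hEZ, integral_const, probReal_univ, one_smul] at hint
  refine hint.trans ?_
  have h4 : ((x + m)⁻¹ ^ 2 * x⁻¹) * ∫ c, Z c ^ 2 ∂(roundLaw G q) ≤
    ((x + m)⁻¹ ^ 2 * x⁻¹) * (b * m + m ^ 2) := by gcongr
  have h5 : (x / (x + m) + b * m / (x + m) ^ 2) * x⁻¹ =
      (x + m)⁻¹ + b * m * ((x + m)⁻¹ ^ 2 * x⁻¹) := by field_simp
  rw [h5]
  linarith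

end Round

/-- The sets of at least `m` vertices. -/
def largeSets (n : ℕ) (m : ℝ) : Set (Finset (Fin n)) := {J | m ≤ (J.card : ℝ)}

lemma mem_largeSets {n : ℕ} {m : ℝ} {J : Finset (Fin n)} : J ∈ largeSets n m ↔ m ≤ (J.card : ℝ) :=
  Iff.rfl

lemma largeSets_mono {n : ℕ} {m : ℝ} (J K : Finset (Fin n)) (hJ : J ∈ largeSets n m) (h : J ⊆ K) :
    K ∈ largeSets n m :=
  le_trans (mem_largeSets.1 hJ) (by exact_mod_cast Finset.card_le_card h)

lemma card_compl_real {n : ℕ} (J : Finset (Fin n)) : (Jᶜ.card : ℝ) = n - J.card := by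
  rw [Finset.card_compl, Fintype.card_fin, Nat.cast_sub]
  simpa using Finset.card_le_univ J

/-! ### Failure bounds for the single phases -/

section Phases

variable {n : ℕ} {G : SimpleGraph (Fin n)} [DecidableRel G.Adj] {q : unitInterval} {pull : Bool}

/-- Contraction of `1 / |J|` at a crude rate, but valid even from a single informed vertex, where
the variance is not negligible. -/
lemma failProb_largeSets_le_of_cut {c m : ℝ} (hc : 0 < c) (hm0 : 0 ≤ m) (hm : m ≤ n / 2)
    (hcut : ∀ J : Finset (Fin n), c * min (J.card : ℝ) (Jᶜ.card : ℝ) ≤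
      expectedGain G q pull (fun _ => 1) J)
    {I : Finset (Fin n)} (hI : I.Nonempty) (t : ℕ) :
    failProb G q pull (largeSets n m) t I ≤
      m * ((1 - (c / (1 + c)) ^ 2) ^ t * (I.card : ℝ)⁻¹) := by
  have hc1 : c / (1 + c) ≤ 1 := (div_le_one (by linarith)).2 (by linarith)
  have hc0 : 0 ≤ c / (1 + c) := by positivity
  refine failProb_le_of_contract (h := fun J => (J.card : ℝ)⁻¹) (by nlinarith) hm0
    (fun J => by positivity) largeSets_mono (fun J hIJ hJ => ?_) (fun J hIJ hJ => ?_) t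
  · rw [mem_largeSets, not_le] at hJ
    have : (0 : ℝ) < J.card := by exact_mod_cast (hI.mono hIJ).card_pos
    rw [← div_eq_mul_inv, one_le_div this]
    exact hJ.le
  · rw [mem_largeSets, not_le] at hJ
    have hJ1 : (1 : ℝ) ≤ J.card := by exact_mod_cast (hI.mono hIJ).card_pos
    have hg := hcut J
    rw [min_eq_left (by rw [card_compl_real]; linarith)] at hg
    have h := transition_inv_sum_le (G := G) (q := q) (pull := pull) (φ := fun _ => 1) (I := J)
      (b := 1) (fun _ => zero_le_one) (fun _ => le_rfl) (by simpa using hI.mono hIJ)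
    simp only [Finset.sum_const, nsmul_eq_mul, mul_one, one_mul] at h
    refine h.trans ?_
    gcongr
    set x : ℝ := (J.card : ℝ)
    set g := expectedGain G q pull (fun _ => 1) J
    have hg0 : 0 < g := lt_of_lt_of_le (by positivity) hg
    have hxg : 0 < x + g := by linarith
    have h1 : c / (1 + c) ≤ g / (x + g) := by
      rw [div_le_div_iff₀ (by linarith) hxg]; nlinarith
    have h2 : (c / (1 + c)) ^ 2 ≤ (g / (x + g)) ^ 2 := by gcongr
    -- After clearing denominators this is `g ≤ x * g`, that is `x ≥ 1`.
    have h3 : x / (x + g) + g / (x + g) ^ 2 ≤ 1 - (g / (x + g)) ^ 2 := by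
      rw [div_pow, div_add_div _ _ (by positivity) (by positivity), one_sub_div (by positivity),
        div_le_div_iff₀ (by positivity) (by positivity)]
      nlinarith [mul_nonneg (mul_nonneg hg0.le (sub_nonneg.2 hJ1)) (pow_pos hxg 3).le]
    linarith

/-- From `k` vertices on, the weight `x` is at least `a * k`, so the variance term `b * g / (x + g)
^ 2` costs at most `b / (a * k)` in the rate. -/
lemma failProb_largeSets_le_of_growth {φ : Fin n → ℝ} {a b γ k m : ℝ} (ha : 0 < a) (hγ : 0 < γ)
    (hk : 0 < k) (hm : 0 ≤ m) (hφa : ∀ w, a ≤ φ w) (hφb : ∀ w, φ w ≤ b)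
    (hgain : ∀ J : Finset (Fin n), (J.card : ℝ) ≤ m →
      γ * ∑ w ∈ J, φ w ≤ expectedGain G q pull φ J)
    {I : Finset (Fin n)} (hI : k ≤ (I.card : ℝ)) (t : ℕ) :
    failProb G q pull (largeSets n m) t I ≤
      b * m * (((1 + γ)⁻¹ + b / (a * k)) ^ t * (a * k)⁻¹) := by
  have hI0 : (0 : ℝ) < I.card := hk.trans_le hI
  obtain ⟨w₀, -⟩ : I.Nonempty := Finset.card_pos.1 (by exact_mod_cast hI0)
  have hb : 0 < b := ha.trans_le ((hφa w₀).trans (hφb w₀))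
  have hφ0 : ∀ w, 0 ≤ φ w := fun w => ha.le.trans (hφa w)
  have hlow : ∀ J : Finset (Fin n), I ⊆ J → a * k ≤ ∑ w ∈ J, φ w := fun J hJ => by
    calc a * k ≤ a * J.card := by
          gcongr
          exact hI.trans (by exact_mod_cast Finset.card_le_card hJ)
      _ = ∑ w ∈ J, a := by simp [mul_comm]
      _ ≤ _ := Finset.sum_le_sum fun w _ => hφa w
  have hak : 0 < a * k := by positivity
  refine (failProb_le_of_contract (h := fun J => (∑ w ∈ J, φ w)⁻¹)
    (ρ := (1 + γ)⁻¹ + b / (a * k)) (x := b * m) (by positivity) (by positivity)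
    (fun J => inv_nonneg.2 (Finset.sum_nonneg fun w _ => hφ0 w)) largeSets_mono
    (fun J hIJ hJ => ?_) (fun J hIJ hJ => ?_) t).trans ?_
  · rw [mem_largeSets, not_le] at hJ
    rw [← div_eq_mul_inv, one_le_div (hak.trans_le (hlow J hIJ))]
    calc ∑ w ∈ J, φ w ≤ ∑ w ∈ J, b := Finset.sum_le_sum fun w _ => hφb w
      _ = b * J.card := by simp [mul_comm]
      _ ≤ _ := by gcongr
  · rw [mem_largeSets, not_le] at hJ
    have hx := hlow J hIJ
    have hx0 := hak.trans_le hx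
    refine (transition_inv_sum_le hφ0 hφb hx0).trans ?_
    have hg := hgain J hJ.le
    set x := ∑ w ∈ J, φ w
    set g := expectedGain G q pull φ J
    have hg0 : 0 < g := lt_of_lt_of_le (by positivity) hg
    gcongr ?_ * _
    refine add_le_add ?_ ?_
    · rw [← one_div, div_le_div_iff₀ (by positivity) (by positivity)]; linarith
    · rw [div_le_div_iff₀ (by positivity) hak]
      have h1 : g * (a * k) ≤ (x + g) ^ 2 := by
        nlinarith [mul_le_mul_of_nonneg_left hx hg0.le]
      nlinarith [mul_le_mul_of_nonneg_left h1 hb.le]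
  · gcongr
    exact hlow I subset_rfl

lemma transition_card_compl (J : Finset (Fin n)) :
    transition G q pull (fun K => (Kᶜ.card : ℝ)) J =
      Jᶜ.card - expectedGain G q pull (fun _ => 1) J := by
  have h := transition_sum (G := G) (q := q) (pull := pull) (φ := fun _ => 1) (I := J)
  have h1 := transition_const_add (G := G) (q := q) (pull := pull) n
    (fun K => -1 * ∑ w ∈ K, (1 : ℝ))
  rw [transition_const_mul] at h1
  have h2 := congrFun h1 J
  beta_reduce at h2
  rw [h] at h2
  rw [card_compl_real]
  simp_rw [card_compl_real]
  simp only [Finset.sum_const, nsmul_eq_mul, mul_one] at h2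
  convert h2 using 2
  · funext K; ring
  · ring

/-- Beyond `n / 2` the uninformed side is the smaller side of the cut, so its expected size
contracts by `1 - c`; Markov's inequality at the level `n / log n` costs only a factor `log n`. -/
lemma failProb_almostAll_le {c : ℝ} (hc1 : c ≤ 1) (hn : 0 < Real.log n)
    (hcut : ∀ J : Finset (Fin n), c * min (J.card : ℝ) (Jᶜ.card : ℝ) ≤
      expectedGain G q pull (fun _ => 1) J)
    {I : Finset (Fin n)} (hI : (n : ℝ) / 2 ≤ (I.card : ℝ)) (t : ℕ) :
    failProb G q pull (largeSets n (n - n / Real.log n)) t I ≤ Real.log n * (1 - c) ^ t := by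
  have hn0 : (0 : ℝ) < n := by
    rcases Nat.eq_zero_or_pos n with rfl | h
    · simp at hn
    · exact_mod_cast h
  have h := failProb_le_of_contract (G := G) (q := q) (pull := pull)
    (A := largeSets n (n - n / Real.log n)) (h := fun J => (Jᶜ.card : ℝ))
    (ρ := 1 - c) (x := Real.log n / n) (I := I) (by linarith) (by positivity)
    (fun J => by positivity) largeSets_mono (fun J hIJ hJ => ?_) (fun J hIJ hJ => ?_) t
  · refine h.trans ?_
    have h1 : (Iᶜ.card : ℝ) ≤ n := by
      rw [card_compl_real]; linarith [(Nat.cast_nonneg I.card : (0:ℝ) ≤ _)]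
    have h2 : 0 ≤ (1 - c) ^ t := pow_nonneg (by linarith) t
    calc _ ≤ Real.log n / n * ((1 - c) ^ t * n) := by gcongr
      _ = _ := by field_simp
  · rw [mem_largeSets, not_le] at hJ
    rw [card_compl_real]
    have h1 : n / Real.log n ≤ n - (J.card : ℝ) := by linarith
    calc (1 : ℝ) = Real.log n / n * (n / Real.log n) := by field_simp
      _ ≤ _ := by gcongr
  · rw [transition_card_compl]
    have hJI : (I.card : ℝ) ≤ J.card := by exact_mod_cast Finset.card_le_card hIJ
    have h1 := hcut J
    rw [min_eq_right (by rw [card_compl_real]; linarith)] at h1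
    linarith

end Phases

/-! ### Joining the phases -/

/-- At `ρ = (1 + γ)⁻¹` the product is `1 + κ * log (1 + γ) > 1`. By continuity a slightly larger `ρ`
still works, which leaves room for the error terms in the rate. -/
lemma exists_rate_lt {γ κ : ℝ} (hγ : 0 < γ) (hκ : 0 < κ) :
    ∃ ρ, (1 + γ)⁻¹ < ρ ∧ ρ < 1 ∧ 1 < -Real.log ρ * ((Real.log (1 + γ))⁻¹ + κ) := by
  have hl : 0 < Real.log (1 + γ) := Real.log_pos (by linarith)
  have h0 : 0 < (1 + γ)⁻¹ := by positivity
  have h1 : (1 + γ)⁻¹ < 1 := inv_lt_one_of_one_lt₀ (by linarith)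
  have hcont : ContinuousAt (fun ρ => -Real.log ρ * ((Real.log (1 + γ))⁻¹ + κ)) (1 + γ)⁻¹ :=
    ((Real.continuousAt_log h0.ne').neg).mul continuousAt_const
  have hval : 1 < -Real.log (1 + γ)⁻¹ * ((Real.log (1 + γ))⁻¹ + κ) := by
    rw [Real.log_inv, neg_neg, mul_add, mul_inv_cancel₀ hl.ne']
    nlinarith
  have hev := (hcont.eventually (lt_mem_nhds hval)).and (gt_mem_nhds h1)
  have hev' := (hev.filter_mono nhdsWithin_le_nhds).and (self_mem_nhdsWithin (s := Set.Ioi (1 + γ)⁻¹))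
  obtain ⟨ρ, ⟨h2, h3⟩, h4⟩ := hev'.exists
  exact ⟨ρ, h4, h3, h2⟩

lemma tendsto_ceil_mul_log {κ : ℝ} (hκ : 0 < κ) :
    Tendsto (fun n : ℕ => ⌈κ * Real.log n⌉₊) atTop atTop :=
  tendsto_nat_ceil_atTop.comp
    ((Real.tendsto_log_atTop.comp tendsto_natCast_atTop_atTop).const_mul_atTop hκ)

/-- The number of rounds after which almost all vertices are informed, if small informed sets grow
by a factor `1 + γ` with respect to a weight `φ`, and every cut is crossed. -/
theorem exists_time_failProb_almostAll_le (H : (n : ℕ) → SimpleGraph (Fin n))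
    [∀ n, DecidableRel (H n).Adj] (q : unitInterval) (pull : Bool) {γ a b c : ℝ} (hγ : 0 < γ)
    (ha : 0 < a) (hab : a ≤ b) (hc : 0 < c) (hc1 : c ≤ 1)
    (hcut : ∀ᶠ n : ℕ in atTop, ∀ J : Finset (Fin n), c * min (J.card : ℝ) (Jᶜ.card : ℝ) ≤
      expectedGain (H n) q pull (fun _ => 1) J)
    (hgrow : ∀ ξ : ℝ, 0 < ξ → ∃ θ : ℝ, 0 < θ ∧ ∀ᶠ n : ℕ in atTop, ∃ φ : Fin n → ℝ,
      (∀ w, a ≤ φ w) ∧ (∀ w, φ w ≤ b) ∧ ∀ J : Finset (Fin n), (J.card : ℝ) ≤ θ * n →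
        (γ - ξ) * ∑ w ∈ J, φ w ≤ expectedGain (H n) q pull φ J)
    {κ η : ℝ} (hκ : 0 < κ) (hη : 0 < η) :
    ∀ᶠ n : ℕ in atTop, ∃ t : ℕ,
      (t : ℝ) ≤ (Real.log (1 + γ))⁻¹ * Real.log n + κ * Real.log n ∧
      ∀ v : Fin n, failProb (H n) q pull (largeSets n (n - n / Real.log n)) t {v} ≤ η := by
  have hb : 0 < b := ha.trans_le hab
  -- Three phases of length `κ' log n` and the surplus `2 κ' log n` of the growth phase use five
  -- sixths; the last sixth absorbs the four roundings, at most `4 ≤ κ' log n`.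
  obtain ⟨κ', hκ', hκκ⟩ : ∃ κ', 0 < κ' ∧ κ = 6 * κ' := ⟨κ / 6, by positivity, by ring⟩
  obtain ⟨ρ, hρ1, hρ2, hρ3⟩ := exists_rate_lt hγ hκ'
  have hρ0 : 0 < ρ := lt_trans (by positivity) hρ1
  set β := (Real.log (1 + γ))⁻¹ with hβ
  have hβ0 : 0 < β := inv_pos.2 (Real.log_pos (by linarith))
  -- the loss `ξ` in the growth factor and the size `k` at which concentration sets in
  obtain ⟨ξ, hξ, hξγ, hξρ⟩ : ∃ ξ, 0 < ξ ∧ ξ < γ ∧ (1 + (γ - ξ))⁻¹ < ((1 + γ)⁻¹ + ρ) / 2 := by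
    have hcont : ContinuousAt (fun ξ : ℝ => (1 + (γ - ξ))⁻¹) 0 :=
      ContinuousAt.inv₀ (by fun_prop) (by simp; positivity)
    have hval : (1 + (γ - 0))⁻¹ < ((1 + γ)⁻¹ + ρ) / 2 := by rw [sub_zero]; linarith
    have hev := (hcont.eventually (gt_mem_nhds hval)).and (gt_mem_nhds hγ)
    have hev' := (hev.filter_mono nhdsWithin_le_nhds).and
      (self_mem_nhdsWithin (s := Set.Ioi (0 : ℝ)))
    obtain ⟨ξ, ⟨h2, h3⟩, h4⟩ := hev'.exists
    exact ⟨ξ, h4, h3, h2⟩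
  obtain ⟨k, hk, hkρ⟩ : ∃ k, 0 < k ∧ b / (a * k) ≤ (ρ - (1 + γ)⁻¹) / 2 := by
    refine ⟨2 * b / (a * (ρ - (1 + γ)⁻¹)), ?_, le_of_eq ?_⟩
    · have := sub_pos.2 hρ1
      positivity
    · have := (sub_pos.2 hρ1).ne'
      generalize ρ - (1 + γ)⁻¹ = y at *
      field_simp
  -- One half of the gap between `(1 + γ)⁻¹` and `ρ` pays for `ξ`, the other half for the variance.
  have hrate : (1 + (γ - ξ))⁻¹ + b / (a * k) ≤ ρ := by linarith
  obtain ⟨θ, hθ, hgrow⟩ := hgrow ξ hξ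
  -- the lengths of the phases
  set L : ℕ → ℝ := fun n => Real.log n with hL
  have hLt : Tendsto L atTop atTop := Real.tendsto_log_atTop.comp tendsto_natCast_atTop_atTop
  set τ : ℕ → ℕ := fun n => ⌈κ' * L n⌉₊ with hτ
  have hτt : Tendsto τ atTop atTop := tendsto_ceil_mul_log hκ'
  set ρ₀ := 1 - (c / (1 + c)) ^ 2 with hρ₀
  have hcc : 0 < c / (1 + c) := by positivity
  have hcc1 : c / (1 + c) ≤ 1 := (div_le_one (by linarith)).2 (by linarith)
  have hρ₀0 : 0 ≤ ρ₀ := by nlinarith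
  have hρ₀1 : ρ₀ < 1 := by nlinarith
  have hpow : Tendsto (fun n => ρ₀ ^ τ n) atTop (𝓝 0) :=
    (tendsto_pow_atTop_nhds_zero_of_lt_one hρ₀0 hρ₀1).comp hτt
  have e0 : ∀ᶠ n in atTop, k * ρ₀ ^ τ n ≤ η / 4 := by
    have := hpow.const_mul k
    rw [mul_zero] at this
    exact this.eventually_le_const (by positivity)
  have e2 : ∀ᶠ n in atTop, (2 * θ)⁻¹ * ρ₀ ^ τ n ≤ η / 4 := by
    have := hpow.const_mul (2 * θ)⁻¹
    rw [mul_zero] at this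
    exact this.eventually_le_const (by positivity)
  have e3 : ∀ᶠ n in atTop, L n * (1 - c) ^ τ n ≤ η / 4 := by
    have h1 := ((tendsto_self_mul_const_pow_of_lt_one (r := 1 - c) (by linarith)
      (by linarith)).comp hτt).const_mul κ'⁻¹
    rw [mul_zero] at h1
    filter_upwards [h1.eventually_le_const (show (0:ℝ) < η / 4 by positivity)] with n hn
    refine le_trans ?_ hn
    simp only [Function.comp]
    rw [← mul_assoc]
    refine mul_le_mul_of_nonneg_right ?_ (pow_nonneg (by linarith) _)
    rw [inv_mul_eq_div, le_div_iff₀ hκ', mul_comm]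
    exact Nat.le_ceil _
  have hlogρ : 0 < -Real.log ρ := neg_pos.2 (Real.log_neg hρ0 hρ2)
  -- By the choice of `ρ`, `(β + κ') log n` rounds already produce a factor `n⁻¹`, cancelling the
  -- target size `θ n`; the further `κ' log n` rounds make the bound tend to `0`.
  have e1 : ∀ᶠ n : ℕ in atTop,
      b * (θ * n) * (ρ ^ ⌈(β + 2 * κ') * L n⌉₊ * (a * k)⁻¹) ≤ η / 4 := by
    have h1 : Tendsto (fun n => b * θ * (a * k)⁻¹ * Real.exp (-(-Real.log ρ * κ' * L n))) atTop
        (𝓝 0) := by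
      have := (Real.tendsto_exp_neg_atTop_nhds_zero.comp
        (hLt.const_mul_atTop (mul_pos hlogρ hκ'))).const_mul (b * θ * (a * k)⁻¹)
      rw [mul_zero] at this
      exact this
    filter_upwards [h1.eventually_le_const (show (0:ℝ) < η / 4 by positivity),
      eventually_ge_atTop 1] with n hn hn1
    refine le_trans ?_ hn
    have hn0 : (0 : ℝ) < n := by exact_mod_cast hn1
    have hL0 : 0 ≤ L n := Real.log_natCast_nonneg n
    have h2 : ρ ^ ⌈(β + 2 * κ') * L n⌉₊ ≤ Real.exp (-(-Real.log ρ * κ' * L n)) * (n : ℝ)⁻¹ := by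
      rw [← Real.rpow_natCast, Real.rpow_def_of_pos hρ0]
      have : (n : ℝ)⁻¹ = Real.exp (-L n) := by rw [Real.exp_neg, hL, Real.exp_log hn0]
      rw [this, ← Real.exp_add]
      apply Real.exp_le_exp.2
      have h3 := mul_le_mul_of_nonneg_left (Nat.le_ceil ((β + 2 * κ') * L n)) hlogρ.le
      nlinarith [mul_le_mul_of_nonneg_right hρ3.le hL0]
    calc _ ≤ b * (θ * n) * (Real.exp (-(-Real.log ρ * κ' * L n)) * (n : ℝ)⁻¹ * (a * k)⁻¹) := by
          gcongr
      _ = _ := by field_simp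
  filter_upwards [e0, e1, e2, e3, hcut, hgrow, hLt.eventually_ge_atTop (4 / κ'),
    hLt.eventually_gt_atTop 0, tendsto_natCast_atTop_atTop.eventually_ge_atTop (2 * k)]
    with n e0 e1 e2 e3 hcut hgrow hn4 hL0 hnk
  obtain ⟨φ, hφa, hφb, hgain⟩ := hgrow
  have hn0 : (0 : ℝ) < n := by linarith
  -- The phases lead from `1` to `k`, to `θ n`, to `n / 2` and to `n - n / log n`; each fails with
  -- probability at most `η / 4`.
  refine ⟨τ n + (⌈(β + 2 * κ') * L n⌉₊ + (τ n + τ n)), ?_, fun v => ?_⟩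
  · have h1 : (τ n : ℝ) < κ' * L n + 1 := Nat.ceil_lt_add_one (by positivity)
    have h2 : (⌈(β + 2 * κ') * L n⌉₊ : ℝ) < (β + 2 * κ') * L n + 1 :=
      Nat.ceil_lt_add_one (by positivity)
    rw [div_le_iff₀ hκ'] at hn4
    push_cast
    rw [hκκ]
    linarith
  have p0 : failProb (H n) q pull (largeSets n k) (τ n) {v} ≤ η / 4 := by
    refine (failProb_largeSets_le_of_cut hc hk.le (by linarith) hcut
      (Finset.singleton_nonempty v) _).trans ?_
    simpa using e0
  have p1 : ∀ J ∈ largeSets n k, failProb (H n) q pull (largeSets n (θ * n))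
      ⌈(β + 2 * κ') * L n⌉₊ J ≤ η / 4 := fun J hJ => by
    refine (failProb_largeSets_le_of_growth ha (sub_pos.2 hξγ) hk (by positivity) hφa hφb hgain
      hJ _).trans (le_trans ?_ e1)
    have : 0 < 1 + (γ - ξ) := by linarith
    gcongr
  have p2 : ∀ J ∈ largeSets n (θ * n), failProb (H n) q pull (largeSets n (n / 2))
      (τ n) J ≤ η / 4 := fun J hJ => by
    rw [mem_largeSets] at hJ
    have hJ0 : (0 : ℝ) < J.card := lt_of_lt_of_le (by positivity) hJ
    refine (failProb_largeSets_le_of_cut hc (by positivity) le_rfl hcut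
      (Finset.card_pos.1 (by exact_mod_cast hJ0)) _).trans (le_trans ?_ e2)
    calc _ ≤ (n : ℝ) / 2 * (ρ₀ ^ τ n * (θ * n)⁻¹) := by gcongr
      _ = _ := by field_simp
  have p3 : ∀ J ∈ largeSets n (n / 2), failProb (H n) q pull
      (largeSets n (n - n / Real.log n)) (τ n) J ≤ η / 4 := fun J hJ =>
    (failProb_almostAll_le hc1 hL0 hcut hJ _).trans e3
  have hη4 : 0 ≤ η / 4 := by positivity
  calc _ ≤ η / 4 + (η / 4 + (η / 4 + η / 4)) :=
        failProb_add_le (by positivity) p0 fun J hJ => failProb_add_le (by positivity) (p1 J hJ)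
          fun K hK => failProb_add_le hη4 (p2 K hK) p3
    _ = η := by ring

/-! ### Quadratic forms in an eigenbasis -/

section Spectral

open Matrix

variable {ι : Type*} [Fintype ι] [DecidableEq ι] {A : Matrix ι ι ℝ} (hA : A.IsHermitian)

lemma eigenvector_mulVec (i : ι) :
    A *ᵥ ⇑(hA.eigenvectorBasis i) = hA.eigenvalues i • ⇑(hA.eigenvectorBasis i) :=
  hA.mulVec_eigenvectorBasis i

lemma dotProduct_eq_sum_eigenvectorBasis (x y : ι → ℝ) :
    x ⬝ᵥ y = ∑ i, (⇑(hA.eigenvectorBasis i) ⬝ᵥ x) * (⇑(hA.eigenvectorBasis i) ⬝ᵥ y) := by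
  have h := hA.eigenvectorBasis.sum_inner_mul_inner (WithLp.toLp 2 x) (WithLp.toLp 2 y)
  simp only [EuclideanSpace.inner_eq_star_dotProduct, star_trivial] at h
  rw [dotProduct_comm x y, ← h]
  refine Finset.sum_congr rfl fun i _ => ?_
  rw [dotProduct_comm y]

lemma eigenvector_dotProduct_mulVec (i : ι) (x : ι → ℝ) :
    ⇑(hA.eigenvectorBasis i) ⬝ᵥ (A *ᵥ x) =
      hA.eigenvalues i * (⇑(hA.eigenvectorBasis i) ⬝ᵥ x) := by
  have hT : Aᵀ = A := by rw [← conjTranspose_eq_transpose_of_trivial]; exact hA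
  rw [dotProduct_mulVec, ← mulVec_transpose, hT, eigenvector_mulVec hA, smul_dotProduct,
    smul_eq_mul]

lemma dotProduct_mulVec_eq_sum (x : ι → ℝ) :
    x ⬝ᵥ (A *ᵥ x) = ∑ i, hA.eigenvalues i * (⇑(hA.eigenvectorBasis i) ⬝ᵥ x) ^ 2 := by
  rw [dotProduct_eq_sum_eigenvectorBasis hA]
  simp_rw [eigenvector_dotProduct_mulVec hA]
  exact Finset.sum_congr rfl fun i _ => by ring

lemma mulVec_dotProduct_mulVec_eq_sum (x : ι → ℝ) :
    (A *ᵥ x) ⬝ᵥ (A *ᵥ x) = ∑ i, hA.eigenvalues i ^ 2 * (⇑(hA.eigenvectorBasis i) ⬝ᵥ x) ^ 2 := by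
  rw [dotProduct_eq_sum_eigenvectorBasis hA]
  simp_rw [eigenvector_dotProduct_mulVec hA]
  exact Finset.sum_congr rfl fun i _ => by ring

lemma eigenvector_dotProduct_self (i : ι) :
    ⇑(hA.eigenvectorBasis i) ⬝ᵥ ⇑(hA.eigenvectorBasis i) = 1 := by
  have h := hA.eigenvectorBasis.orthonormal.1 i
  have h2 : inner ℝ (hA.eigenvectorBasis i) (hA.eigenvectorBasis i) = (1 : ℝ) := by
    rw [real_inner_self_eq_norm_sq, h, one_pow]
  rwa [EuclideanSpace.inner_eq_star_dotProduct, star_trivial] at h2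

/-- An eigenvalue is bounded by the maximal absolute row sum. -/
lemma abs_eigenvalue_le {D : ℝ} (hD : ∀ u, ∑ w, |A u w| ≤ D) (i : ι) :
    |hA.eigenvalues i| ≤ D := by
  have hne : Nonempty ι := ⟨i⟩
  set x : ι → ℝ := ⇑(hA.eigenvectorBasis i)
  obtain ⟨u, -, hu⟩ := Finset.exists_max_image Finset.univ (fun u => |x u|) Finset.univ_nonempty
  have hxu : 0 < |x u| := by
    by_contra h
    have h0 : ∀ w, x w = 0 := fun w => by
      have := hu w (Finset.mem_univ w)
      exact abs_eq_zero.1 (le_antisymm (this.trans (not_lt.1 h)) (abs_nonneg _))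
    have := eigenvector_dotProduct_self hA i
    rw [show (⇑(hA.eigenvectorBasis i) : ι → ℝ) = 0 from funext h0] at this
    simp at this
  have h1 : hA.eigenvalues i * x u = ∑ w, A u w * x w :=
    (congrFun (eigenvector_mulVec hA i) u).symm
  have h2 : |hA.eigenvalues i| * |x u| ≤ D * |x u| := by
    rw [← abs_mul, h1]
    calc _ ≤ ∑ w, |A u w * x w| := Finset.abs_sum_le_sum_abs _ _
      _ ≤ ∑ w, |A u w| * |x u| := Finset.sum_le_sum fun w _ => by
          rw [abs_mul]; exact mul_le_mul_of_nonneg_left (hu w (Finset.mem_univ w)) (abs_nonneg _)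
      _ = (∑ w, |A u w|) * |x u| := by rw [Finset.sum_mul]
      _ ≤ _ := by gcongr; exact hD u
  exact le_of_mul_le_mul_right h2 hxu

end Spectral

/-! ### Expander mixing for almost regular graphs -/

section Mixing

open Matrix

variable {n : ℕ} (G : SimpleGraph (Fin n)) [DecidableRel G.Adj]

/-- The number of neighbours of `w` in `S`. -/
def degInto (S : Finset (Fin n)) (w : Fin n) : ℝ := ∑ u ∈ S, if G.Adj w u then 1 else 0

lemma degInto_nonneg (S : Finset (Fin n)) (w : Fin n) : 0 ≤ degInto G S w :=
  Finset.sum_nonneg fun _ _ => by split_ifs <;> simp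

lemma degInto_univ (w : Fin n) : degInto G Finset.univ w = G.degree w := by
  simp [degInto, ← SimpleGraph.card_neighborFinset_eq_degree, SimpleGraph.neighborFinset_eq_filter]

lemma secondEigenvalue_nonneg : 0 ≤ secondEigenvalue G := Real.iSup_nonneg fun _ => abs_nonneg _

/-- In an eigenbasis the leading eigenvalue is bounded by the maximum degree, all others by `λ` in
absolute value. Positivity of the leading vector is not needed. -/
lemma exists_leading_vector (hn : 0 < n) :
    ∃ v : Fin n → ℝ, v ⬝ᵥ v = 1 ∧ ∀ x : Fin n → ℝ,
      x ⬝ᵥ (G.adjMatrix ℝ *ᵥ x) ≤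
        G.maxDegree * (v ⬝ᵥ x) ^ 2 + secondEigenvalue G * (x ⬝ᵥ x) ∧
      (G.adjMatrix ℝ *ᵥ x) ⬝ᵥ (G.adjMatrix ℝ *ᵥ x) ≤
        G.maxDegree ^ 2 * (v ⬝ᵥ x) ^ 2 + secondEigenvalue G ^ 2 * (x ⬝ᵥ x) := by
  set hA := G.isHermitian_adjMatrix ℝ
  -- This is the reindexing behind `eigenvalues`, so `i₀` is the position of `μ_1`.
  let e : Fin (Fintype.card (Fin n)) ≃ Fin n := Fintype.equivOfCardEq (Fintype.card_fin _)
  let i₀ : Fin n := e ⟨0, by simpa using hn⟩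
  have h1 : ∀ i, i ≠ i₀ → |hA.eigenvalues i| ≤ secondEigenvalue G := fun i hi => by
    have hne : ((e.symm i : Fin (Fintype.card (Fin n))) : ℕ) ≠ 0 := fun h => hi (by
      rw [← e.apply_symm_apply i]
      exact congrArg e (Fin.ext h))
    exact le_ciSup (f := fun i : {i : Fin (Fintype.card (Fin n)) // (i : ℕ) ≠ 0} =>
      |hA.eigenvalues₀ i|) (Set.finite_range _).bddAbove ⟨e.symm i, hne⟩
  have h2 : ∀ i, |hA.eigenvalues i| ≤ G.maxDegree := abs_eigenvalue_le hA fun u => by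
    have : ∑ w, |G.adjMatrix ℝ u w| = G.degree u := by
      rw [← degInto_univ, degInto]
      refine Finset.sum_congr rfl fun w _ => ?_
      rw [SimpleGraph.adjMatrix_apply]
      split_ifs <;> simp
    rw [this]
    exact_mod_cast G.degree_le_maxDegree u
  have hl := secondEigenvalue_nonneg G
  have hsplit : ∀ (f : ℝ → ℝ) (D l : ℝ), 0 ≤ l → (∀ i, f (hA.eigenvalues i) ≤ D) →
      (∀ i, i ≠ i₀ → f (hA.eigenvalues i) ≤ l) → ∀ x : Fin n → ℝ,
      ∑ i, f (hA.eigenvalues i) * (⇑(hA.eigenvectorBasis i) ⬝ᵥ x) ^ 2 ≤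
        D * (⇑(hA.eigenvectorBasis i₀) ⬝ᵥ x) ^ 2 + l * (x ⬝ᵥ x) := by
    intro f D l hl hD hfl x
    rw [dotProduct_eq_sum_eigenvectorBasis hA x x, ← Finset.add_sum_erase _ _ (Finset.mem_univ i₀),
      Finset.mul_sum]
    refine add_le_add (by gcongr; exact hD _) ?_
    calc _ ≤ ∑ i ∈ Finset.univ.erase i₀, l * ((⇑(hA.eigenvectorBasis i) ⬝ᵥ x) *
          (⇑(hA.eigenvectorBasis i) ⬝ᵥ x)) := Finset.sum_le_sum fun i hi => by
            rw [← sq]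
            gcongr
            exact hfl i (Finset.ne_of_mem_erase hi)
      _ ≤ _ := Finset.sum_le_sum_of_subset_of_nonneg (Finset.erase_subset _ _) fun i _ _ =>
          mul_nonneg hl (mul_self_nonneg _)
  refine ⟨⇑(hA.eigenvectorBasis i₀), eigenvector_dotProduct_self hA i₀, fun x => ⟨?_, ?_⟩⟩
  · rw [dotProduct_mulVec_eq_sum hA]
    exact hsplit id _ _ hl (fun i => (le_abs_self _).trans (h2 i))
      (fun i hi => (le_abs_self _).trans (h1 i hi)) x
  · rw [mulVec_dotProduct_mulVec_eq_sum hA]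
    refine hsplit (fun y => y ^ 2) _ _ (by positivity) (fun i => ?_) (fun i hi => ?_) x
    · exact sq_le_sq' (neg_le_of_abs_le (h2 i)) (le_of_abs_le (h2 i))
    · exact sq_le_sq' (neg_le_of_abs_le (h1 i hi)) (le_of_abs_le (h1 i hi))

/-- The indicator vector of `S`. -/
def indVec (S : Finset (Fin n)) : Fin n → ℝ := fun w => if w ∈ S then 1 else 0

lemma indVec_dotProduct (S : Finset (Fin n)) (x : Fin n → ℝ) : indVec S ⬝ᵥ x = ∑ w ∈ S, x w := by
  simp [indVec, dotProduct]

lemma indVec_dotProduct_self (S : Finset (Fin n)) : indVec S ⬝ᵥ indVec S = S.card := by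
  rw [indVec_dotProduct]
  simp [indVec]

lemma adjMatrix_mulVec_indVec (S : Finset (Fin n)) :
    G.adjMatrix ℝ *ᵥ indVec S = degInto G S := by
  funext w
  simp only [mulVec, dotProduct, indVec, degInto, SimpleGraph.adjMatrix_apply, mul_ite, mul_one,
    mul_zero, Finset.sum_ite_mem, Finset.univ_inter]

/-- Cauchy–Schwarz after splitting the indicator of `S` into its mean and the rest. -/
lemma sq_dotProduct_indVec_le (hn : 0 < n) {v : Fin n → ℝ} (hv : v ⬝ᵥ v = 1) {τ ζ : ℝ}
    (hζ : 0 < ζ) (hτ : 1 - (∑ w, v w) ^ 2 / n ≤ τ) (S : Finset (Fin n)) :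
    (v ⬝ᵥ indVec S) ^ 2 ≤ (1 + ζ) * ((S.card : ℝ) ^ 2 / n) + (1 + ζ⁻¹) * (τ * S.card) := by
  have hn0 : (0 : ℝ) < n := by exact_mod_cast hn
  set b := ∑ w, v w with hb
  set s : ℝ := (S.card : ℝ) with hs
  set y : Fin n → ℝ := fun w => indVec S w - s / n with hy
  set u : Fin n → ℝ := fun w => v w - b / n with hu
  have hI : ∑ w, indVec S w = s := by simp [indVec, hs]
  have hI2 : ∑ w, indVec S w ^ 2 = s := by
    rw [hs, ← indVec_dotProduct_self, dotProduct]; simp [sq]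
  have hv2 : ∑ w, v w ^ 2 = 1 := by rw [← hv, dotProduct]; simp [sq]
  have hcs := Finset.sum_mul_sq_le_sq_mul_sq Finset.univ u y
  have huy : ∑ w, u w * y w = v ⬝ᵥ indVec S - b * s / n := by
    have : ∀ w, u w * y w = v w * indVec S w - (s / n) * v w - (b / n) * indVec S w
        + b / n * (s / n) := fun w => by simp only [hu, hy]; ring
    simp_rw [this]
    rw [Finset.sum_add_distrib, Finset.sum_sub_distrib, Finset.sum_sub_distrib, ← Finset.mul_sum,
      ← Finset.mul_sum, hI, ← hb, Finset.sum_const, Finset.card_univ, Fintype.card_fin,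
      nsmul_eq_mul, dotProduct]
    field_simp; ring
  -- The squared distance of `v` from the constant vectors, which `τ` bounds.
  have hu2 : ∑ w, u w ^ 2 = 1 - b ^ 2 / n := by
    have : ∀ w, u w ^ 2 = v w ^ 2 - (2 * (b / n)) * v w + (b / n) ^ 2 := fun w => by
      simp only [hu]; ring
    simp_rw [this]
    rw [Finset.sum_add_distrib, Finset.sum_sub_distrib, ← Finset.mul_sum, ← hb, hv2,
      Finset.sum_const, Finset.card_univ, Fintype.card_fin, nsmul_eq_mul]
    field_simp; ring
  have hy2 : ∑ w, y w ^ 2 = s - s ^ 2 / n := by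
    have : ∀ w, y w ^ 2 = indVec S w ^ 2 - (2 * (s / n)) * indVec S w + (s / n) ^ 2 := fun w => by
      simp only [hy]; ring
    simp_rw [this]
    rw [Finset.sum_add_distrib, Finset.sum_sub_distrib, ← Finset.mul_sum, hI, hI2,
      Finset.sum_const, Finset.card_univ, Fintype.card_fin, nsmul_eq_mul]
    field_simp; ring
  rw [huy, hu2, hy2] at hcs
  have hb1 : 0 ≤ 1 - b ^ 2 / n := hu2 ▸ Finset.sum_nonneg fun _ _ => sq_nonneg _
  have hs0 : 0 ≤ s := Nat.cast_nonneg _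
  have hr : (v ⬝ᵥ indVec S - b * s / n) ^ 2 ≤ τ * s := by
    refine hcs.trans (mul_le_mul hτ ?_ ?_ (hb1.trans hτ))
    · have : 0 ≤ s ^ 2 / n := by positivity
      linarith
    · exact hy2 ▸ Finset.sum_nonneg fun _ _ => sq_nonneg _
  have hp : (b * s / n) ^ 2 ≤ s ^ 2 / n := by
    have : (b * s / n) ^ 2 = (b ^ 2 / n) * (s ^ 2 / n) := by field_simp
    rw [this]
    exact mul_le_of_le_one_left (by positivity) (by linarith)
  have hab : ∀ p r : ℝ, (p + r) ^ 2 ≤ (1 + ζ) * p ^ 2 + (1 + ζ⁻¹) * r ^ 2 := fun p r => by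
    have h : (1 + ζ) * p ^ 2 + (1 + ζ⁻¹) * r ^ 2 - (p + r) ^ 2 = ζ⁻¹ * (ζ * p - r) ^ 2 := by
      field_simp; ring
    have : 0 ≤ ζ⁻¹ * (ζ * p - r) ^ 2 := by positivity
    linarith
  calc (v ⬝ᵥ indVec S) ^ 2 = (b * s / n + (v ⬝ᵥ indVec S - b * s / n)) ^ 2 := by ring
    _ ≤ _ := hab _ _
    _ ≤ _ := by gcongr

lemma degree_ratio_inv {G : (n : ℕ) → SimpleGraph (Fin n)} [∀ n, DecidableRel (G n).Adj]
    (hG : IsExpanderSequence G) :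
    Tendsto (fun n => ((G n).minDegree : ℝ) / ((G n).maxDegree : ℝ)) atTop (𝓝 1) := by
  have := hG.degree_ratio.inv₀ one_ne_zero
  simpa using this

/-- With `x / 0 = 0`, the degree ratio is `0` as soon as either degree vanishes, but it tends to
`1`. -/
lemma eventually_minDegree_pos {G : (n : ℕ) → SimpleGraph (Fin n)} [∀ n, DecidableRel (G n).Adj]
    (hG : IsExpanderSequence G) :
    ∀ᶠ n in atTop, (0 : ℝ) < (G n).minDegree ∧ (0 : ℝ) < (G n).maxDegree := by
  filter_upwards [hG.degree_ratio.eventually (lt_mem_nhds zero_lt_one)] with n hn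
  have h1 : (0 : ℝ) ≤ (G n).minDegree := Nat.cast_nonneg _
  have h2 : (0 : ℝ) ≤ (G n).maxDegree := Nat.cast_nonneg _
  constructor
  · refine lt_of_le_of_ne h1 fun h => ?_
    rw [← h] at hn; simp at hn
  · refine lt_of_le_of_ne h2 fun h => ?_
    rw [← h] at hn; simp at hn

/-- The expander mixing property. -/
theorem eventually_mixing {G : (n : ℕ) → SimpleGraph (Fin n)} [∀ n, DecidableRel (G n).Adj]
    (hG : IsExpanderSequence G) {ξ : ℝ} (hξ : 0 < ξ) :
    ∀ᶠ n in atTop, ∀ S : Finset (Fin n),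
      ∑ w ∈ S, degInto (G n) S w ≤
        (G n).maxDegree * ((S.card : ℝ) ^ 2 / n + ξ * S.card) ∧
      ∑ w, degInto (G n) S w ^ 2 ≤
        (G n).maxDegree ^ 2 * ((S.card : ℝ) ^ 2 / n + ξ * S.card) := by
  obtain ⟨ζ, hζ, hζξ⟩ : ∃ ζ, 0 < ζ ∧ ξ = 3 * ζ := ⟨ξ / 3, by positivity, by ring⟩
  have hl : Tendsto (fun n => secondEigenvalue (G n) / ((G n).maxDegree : ℝ)) atTop (𝓝 0) :=
    hG.eigenvalue_isLittleO.tendsto_div_nhds_zero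
  have hτ : Tendsto (fun n => (1 + ζ⁻¹) * (1 - (((G n).minDegree : ℝ) / ((G n).maxDegree : ℝ) -
      secondEigenvalue (G n) / ((G n).maxDegree : ℝ)))) atTop (𝓝 0) := by
    have := (((degree_ratio_inv hG).sub hl).const_sub 1).const_mul (1 + ζ⁻¹)
    simpa using this
  filter_upwards [hτ.eventually_le_const hζ, hl.eventually_le_const hζ,
    hl.eventually_le_const one_pos, eventually_minDegree_pos hG, eventually_gt_atTop 0]
    with n h1 h2 h3 ⟨hδ, hΔ⟩ hn S
  have hn0 : (0 : ℝ) < n := by exact_mod_cast hn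
  obtain ⟨v, hv, hvx⟩ := exists_leading_vector (G n) hn
  set Δ : ℝ := ((G n).maxDegree : ℝ)
  set δ : ℝ := ((G n).minDegree : ℝ)
  set l := secondEigenvalue (G n)
  have hl0 : 0 ≤ l := secondEigenvalue_nonneg _
  have hdiv : 0 ≤ l / Δ := by positivity
  -- Testing with the all-ones vector gives `δ n ≤ Δ (∑ v)² + λ n`, so `(∑ v)² / n ≥ δ / Δ - λ / Δ →
  -- 1`: the leading vector is almost constant.
  have hone := (hvx (indVec Finset.univ)).1
  rw [indVec_dotProduct_self, adjMatrix_mulVec_indVec, indVec_dotProduct, dotProduct_comm v,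
    indVec_dotProduct, Finset.card_univ, Fintype.card_fin] at hone
  have hdeg : δ * n ≤ ∑ w, degInto (G n) Finset.univ w := by
    calc δ * n = ∑ _w : Fin n, δ := by simp [mul_comm]
      _ ≤ _ := Finset.sum_le_sum fun w _ => by
        rw [degInto_univ]; exact Nat.cast_le.2 ((G n).minDegree_le_degree w)
  have hτ' : 1 - (∑ w, v w) ^ 2 / n ≤ 1 - (δ / Δ - l / Δ) := by
    have h4 : δ / Δ - l / Δ ≤ (∑ w, v w) ^ 2 / n := by
      rw [← sub_div, div_le_div_iff₀ hΔ hn0]; linarith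
    linarith
  have ha := sq_dotProduct_indVec_le hn hv hζ hτ' S
  have hs0 : (0 : ℝ) ≤ S.card := Nat.cast_nonneg _
  have hsn : (S.card : ℝ) ^ 2 / n ≤ S.card := by
    rw [div_le_iff₀ hn0, sq]
    gcongr
    simpa using Finset.card_le_univ S
  have ha' : (v ⬝ᵥ indVec S) ^ 2 ≤ (S.card : ℝ) ^ 2 / n + 2 * ζ * S.card := by
    have h5 := mul_le_mul_of_nonneg_right h1 hs0
    have h6 := mul_le_mul_of_nonneg_left hsn hζ.le
    linarith
  obtain ⟨hq1, hq2⟩ := hvx (indVec S)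
  rw [indVec_dotProduct_self, adjMatrix_mulVec_indVec] at hq1 hq2
  rw [indVec_dotProduct] at hq1
  have hlΔ : l ≤ ζ * Δ := (div_le_iff₀ hΔ).1 h2
  have hl1 : l ≤ Δ := by simpa using (div_le_iff₀ hΔ).1 h3
  constructor
  · refine hq1.trans ?_
    have h5 := mul_le_mul_of_nonneg_left ha' hΔ.le
    have h6 := mul_le_mul_of_nonneg_right hlΔ hs0
    rw [hζξ]; linarith
  · have : ∑ w, degInto (G n) S w ^ 2 = degInto (G n) S ⬝ᵥ degInto (G n) S := by
      simp [dotProduct, sq]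
    rw [this]
    refine hq2.trans ?_
    have h5 := mul_le_mul_of_nonneg_left ha' (sq_nonneg Δ)
    have h6 : l ^ 2 ≤ ζ * Δ ^ 2 := by nlinarith
    have h7 := mul_le_mul_of_nonneg_right h6 hs0
    rw [hζξ]; linarith

end Mixing

section Fixed

variable {n : ℕ} {G H : SimpleGraph (Fin n)} [DecidableRel G.Adj] [DecidableRel H.Adj]

lemma degInto_le_of_le (h : H ≤ G) (S : Finset (Fin n)) (w : Fin n) :
    degInto H S w ≤ degInto G S w :=
  Finset.sum_le_sum fun u _ => by
    by_cases hu : H.Adj w u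
    · simp [hu, h hu]
    · simp only [hu, if_false]; split_ifs <;> simp

lemma degInto_add_compl (S : Finset (Fin n)) (w : Fin n) :
    degInto H S w + degInto H Sᶜ w = H.degree w := by
  rw [← degInto_univ, degInto, degInto, Finset.sum_add_sum_compl, degInto]

lemma degInto_le_degree (S : Finset (Fin n)) (w : Fin n) : degInto H S w ≤ H.degree w := by
  rw [← degInto_add_compl S w]; linarith [degInto_nonneg H Sᶜ w]

lemma degInto_le_card (S : Finset (Fin n)) (w : Fin n) : degInto H S w ≤ S.card := by
  calc degInto H S w ≤ ∑ _u ∈ S, (1 : ℝ) :=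
        Finset.sum_le_sum fun u _ => by split_ifs <;> simp
    _ = _ := by simp

lemma sum_degInto_comm (S T : Finset (Fin n)) :
    ∑ w ∈ S, degInto H T w = ∑ w ∈ T, degInto H S w := by
  simp only [degInto]
  rw [Finset.sum_comm]
  simp_rw [H.adj_comm]

end Fixed

/-! ### Cuts and push growth after the deletion -/

section Sequence

variable {G H : (n : ℕ) → SimpleGraph (Fin n)} [∀ n, DecidableRel (G n).Adj]
  [∀ n, DecidableRel (H n).Adj] {ε : ℝ}

lemma eventually_degree_bounds (hε : 0 < ε) (hG : IsExpanderSequence G)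
    (hH : ∀ n, IsDeletion (1 / 2 + ε) (G n) (H n)) :
    ∀ᶠ n in atTop, (0 : ℝ) < (G n).minDegree ∧
      2 * ((G n).maxDegree : ℝ) ≤ 3 * (G n).minDegree ∧
      ∀ v, ((G n).minDegree : ℝ) / 2 ≤ (H n).degree v ∧
        ((H n).degree v : ℝ) ≤ (G n).maxDegree := by
  filter_upwards [eventually_minDegree_pos hG,
    hG.degree_ratio.eventually_le_const (show (1 : ℝ) < 3 / 2 by norm_num)] with n ⟨hδ, hΔ⟩ hr
  rw [div_le_iff₀ hδ] at hr
  refine ⟨hδ, by linarith, fun v => ⟨?_, ?_⟩⟩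
  · have h1 := (hH n).degree_le v
    have h2 : ((G n).minDegree : ℝ) ≤ (G n).degree v := by
      exact_mod_cast (G n).minDegree_le_degree v
    nlinarith
  · have h1 : (H n).degree v ≤ (G n).degree v := SimpleGraph.degree_le_of_le (hH n).le
    exact_mod_cast h1.trans ((G n).degree_le_maxDegree v)

/-- Deleting less than half of the edges at every vertex leaves a positive fraction of every cut. -/
lemma eventually_cut (hε : 0 < ε) (hε₁ : ε < 1 / 2) (hG : IsExpanderSequence G)
    (hH : ∀ n, IsDeletion (1 / 2 + ε) (G n) (H n)) :
    ∀ᶠ n in atTop, ∀ S : Finset (Fin n),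
      ε / 2 * (G n).maxDegree * min (S.card : ℝ) (Sᶜ.card : ℝ) ≤
        ∑ w ∈ Sᶜ, degInto (H n) S w := by
  have hξ : 0 < ε / 4 := by positivity
  filter_upwards [eventually_mixing hG hξ, eventually_minDegree_pos hG, eventually_gt_atTop 0,
    (degree_ratio_inv hG).eventually_const_le (show 1 - ε / 4 < 1 by linarith)]
    with n hmix ⟨hδ, hΔ⟩ hn hr
  have hn0 : (0 : ℝ) < n := by exact_mod_cast hn
  rw [le_div_iff₀ hΔ] at hr
  have key : ∀ S : Finset (Fin n), (S.card : ℝ) ≤ n / 2 →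
      ε / 2 * (G n).maxDegree * S.card ≤ ∑ w ∈ S, degInto (H n) Sᶜ w := by
    intro S hS
    have h1 : ∑ w ∈ S, degInto (H n) Sᶜ w =
        ∑ w ∈ S, ((H n).degree w : ℝ) - ∑ w ∈ S, degInto (H n) S w := by
      rw [← Finset.sum_sub_distrib]
      exact Finset.sum_congr rfl fun w _ => by linarith [degInto_add_compl (H := H n) S w]
    have h2 : (1 / 2 + ε) * (G n).minDegree * S.card ≤ ∑ w ∈ S, ((H n).degree w : ℝ) := by
      calc _ = ∑ _w ∈ S, (1 / 2 + ε) * ((G n).minDegree : ℝ) := by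
            rw [Finset.sum_const, nsmul_eq_mul]; ring
        _ ≤ _ := Finset.sum_le_sum fun w _ => by
            refine le_trans ?_ ((hH n).degree_le w)
            gcongr
            exact (G n).minDegree_le_degree w
    have h3 : ∑ w ∈ S, degInto (H n) S w ≤ ∑ w ∈ S, degInto (G n) S w :=
      Finset.sum_le_sum fun w _ => degInto_le_of_le (hH n).le S w
    have h4 := (hmix S).1
    have hs0 : (0 : ℝ) ≤ S.card := Nat.cast_nonneg _
    have h5 : (S.card : ℝ) ^ 2 / n ≤ S.card / 2 := by
      rw [div_le_iff₀ hn0]; nlinarith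
    set Δ : ℝ := ((G n).maxDegree : ℝ)
    have h6 : Δ * ((S.card : ℝ) ^ 2 / n + ε / 4 * S.card) ≤
        Δ * (S.card / 2 + ε / 4 * S.card) := by gcongr
    have h7 : (1 / 2 + ε) * ((1 - ε / 4) * Δ) * S.card ≤
        (1 / 2 + ε) * (G n).minDegree * S.card := by gcongr
    have h8 : 0 ≤ Δ * S.card := by positivity
    -- Comparing coefficients, `(1/2 + ε)(1 - ε/4) - (1/2 + ε/4) = ε (5/8 - ε/4) ≥ ε / 2`, because
    -- `ε < 1/2`.
    nlinarith [mul_nonneg (mul_nonneg hε.le h8) (sub_nonneg.2 hε₁.le)]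
  intro S
  have hc := card_compl_real S
  rcases le_total (S.card : ℝ) (Sᶜ.card : ℝ) with h | h
  · rw [min_eq_left h, ← sum_degInto_comm]
    exact key S (by linarith)
  · rw [min_eq_right h]
    have := key Sᶜ (by linarith)
    rwa [compl_compl] at this

variable (q : unitInterval)

section Rates

variable {n : ℕ} {G H : SimpleGraph (Fin n)} [DecidableRel G.Adj] [DecidableRel H.Adj]
  {d D : ℝ}

/-- The bound is in terms of neighbours in the larger graph `G`, because mixing is known for `G` and
not for `H`. -/
lemma sum_callProb_le (hd : 0 < d) (hdeg : ∀ v, d ≤ (H.degree v : ℝ)) (hHG : H ≤ G)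
    (S : Finset (Fin n)) (w : Fin n) :
    ∑ u ∈ S, callProb H q u w ≤ d⁻¹ * degInto G S w := by
  refine le_trans ?_ (mul_le_mul_of_nonneg_left (degInto_le_of_le hHG S w) (inv_nonneg.2 hd.le))
  rw [degInto, Finset.mul_sum]
  refine Finset.sum_le_sum fun u _ => ?_
  have hu : (0 : ℝ) < H.degree u := hd.trans_le (hdeg u)
  rw [callProb_eq q (by exact_mod_cast hu)]
  simp only [H.adj_comm w u]
  split_ifs
  · rw [mul_one, ← one_div]
    exact div_le_div₀ zero_le_one q.2.2 hd (hdeg u)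
  · simp

lemma le_sum_callProb (hpos : ∀ v, 0 < H.degree v) (hdeg : ∀ v, (H.degree v : ℝ) ≤ D)
    (S : Finset (Fin n)) (w : Fin n) :
    q / D * degInto H S w ≤ ∑ u ∈ S, callProb H q u w := by
  rw [degInto, Finset.mul_sum]
  refine Finset.sum_le_sum fun u _ => ?_
  have hu : (0 : ℝ) < H.degree u := by exact_mod_cast hpos u
  rw [callProb_eq q (hpos u)]
  simp only [H.adj_comm w u]
  split_ifs
  · rw [mul_one]
    exact div_le_div_of_nonneg_left q.2.1 hu (hdeg u)
  · simp

lemma sum_univ_callProb {u : Fin n} (hu : 0 < H.degree u) : ∑ w, callProb H q u w = q := by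
  have hu' : (H.degree u : ℝ) ≠ 0 := by exact_mod_cast hu.ne'
  have : ∀ w, callProb H q u w = (q / H.degree u : ℝ) * if H.Adj u w then 1 else 0 := fun w => by
    rw [callProb_eq q hu]; split_ifs <;> simp
  simp_rw [this]
  rw [← Finset.mul_sum]
  change _ * degInto H Finset.univ u = _
  rw [degInto_univ]
  field_simp

lemma contactRate_push (I : Finset (Fin n)) (w : Fin n) :
    contactRate H q false I w = ∑ u ∈ I, callProb H q u w := by simp [contactRate]

end Rates

/-- Every cut is crossed by a positive fraction of the smaller side. -/
lemma eventually_cut_gain (hε : 0 < ε) (hε₁ : ε < 1 / 2) (hG : IsExpanderSequence G)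
    (hH : ∀ n, IsDeletion (1 / 2 + ε) (G n) (H n)) (pull : Bool) :
    ∀ᶠ n : ℕ in atTop, ∀ J : Finset (Fin n),
      q * ε / 8 * min (J.card : ℝ) (Jᶜ.card : ℝ) ≤
        expectedGain (H n) q pull (fun _ => 1) J := by
  filter_upwards [eventually_cut hε hε₁ hG hH, eventually_degree_bounds hε hG hH]
    with n hcut ⟨hδ, hΔδ, hdeg⟩ J
  set Δ : ℝ := ((G n).maxDegree : ℝ)
  set δ : ℝ := ((G n).minDegree : ℝ)
  have hΔ : 0 < Δ := hδ.trans_le (Nat.cast_le.2 (G n).minDegree_le_maxDegree)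
  have hpos : ∀ v, 0 < (H n).degree v := fun v => by
    have : (0 : ℝ) < (H n).degree v := lt_of_lt_of_le (by positivity) (hdeg v).1
    exact_mod_cast this
  have h1 : ∀ w ∈ Jᶜ, q / (4 * Δ) * degInto (H n) J w ≤ informProb (H n) q pull J w := by
    intro w hw
    have hpp : informProb (H n) q false J w ≤ informProb (H n) q pull J w := by
      cases pull
      · exact le_rfl
      · exact informProb_push_le_pushPull _ _ _ _
    refine le_trans ?_ ((le_informProb (H n) q (Finset.mem_compl.1 hw)).trans hpp)
    rw [contactRate_push]
    have hlo := le_sum_callProb q hpos (fun v => (hdeg v).2) J w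
    have hhi := sum_callProb_le q (d := δ / 2) (by positivity) (fun v => (hdeg v).1) (le_refl (H n)) J w
    -- A rate of at most `3` gives `s / (1 + s) ≥ s / 4`; with the cut constant `ε / 2` this
    -- produces `q * ε / 8`.
    have hs3 : ∑ u ∈ J, callProb (H n) q u w ≤ 3 := by
      refine hhi.trans ?_
      have h2 : degInto (H n) J w ≤ Δ := (degInto_le_degree J w).trans (hdeg w).2
      rw [inv_mul_le_iff₀ (by positivity)]
      linarith
    have hs0 : 0 ≤ ∑ u ∈ J, callProb (H n) q u w :=
      Finset.sum_nonneg fun u _ => callProb_nonneg _ _ _ _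
    set s := ∑ u ∈ J, callProb (H n) q u w
    have h3 : s / 4 ≤ s / (1 + s) := div_le_div_of_nonneg_left hs0 (by linarith) (by linarith)
    have h4 : q / (4 * Δ) * degInto (H n) J w = q / Δ * degInto (H n) J w / 4 := by
      field_simp
    rw [h4]
    linarith
  have hq0 : (0 : ℝ) ≤ q := q.2.1
  calc q * ε / 8 * min (J.card : ℝ) (Jᶜ.card : ℝ)
      = q / (4 * Δ) * (ε / 2 * Δ * min (J.card : ℝ) (Jᶜ.card : ℝ)) := by field_simp; ring
    _ ≤ q / (4 * Δ) * ∑ w ∈ Jᶜ, degInto (H n) J w := by gcongr; exact hcut J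
    _ = ∑ w ∈ Jᶜ, q / (4 * Δ) * degInto (H n) J w := Finset.mul_sum _ _ _
    _ ≤ ∑ w ∈ Jᶜ, 1 * informProb (H n) q pull J w := by
        simp_rw [one_mul]; exact Finset.sum_le_sum h1

lemma sub_sq_le_div_one_add {s : ℝ} (hs : 0 ≤ s) : s - s ^ 2 ≤ s / (1 + s) := by
  rw [le_div_iff₀ (by linarith)]
  nlinarith [pow_nonneg hs 3]

/-- The rates `s w` sum to exactly `q * |J|`. The part landing inside `J` is at most `ξ / 4 * |J|`
by the first mixing bound, and the collision loss `∑ s w ^ 2` at most `3 * ξ / 4 * |J|` by the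
second. -/
lemma eventually_push_growth (hε : 0 < ε) (hG : IsExpanderSequence G)
    (hH : ∀ n, IsDeletion (1 / 2 + ε) (G n) (H n)) {ξ : ℝ} (hξ : 0 < ξ) :
    ∀ᶠ n : ℕ in atTop, ∀ J : Finset (Fin n), (J.card : ℝ) ≤ ξ / 24 * n →
      (q - ξ) * J.card ≤ expectedGain (H n) q false (fun _ => 1) J := by
  have hζ : 0 < ξ / 24 := by positivity
  filter_upwards [eventually_mixing hG hζ, eventually_degree_bounds hε hG hH,
    eventually_gt_atTop 0] with n hmix ⟨hδ, hΔδ, hdeg⟩ hn J hJ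
  have hn0 : (0 : ℝ) < n := by exact_mod_cast hn
  set Δ : ℝ := ((G n).maxDegree : ℝ)
  set δ : ℝ := ((G n).minDegree : ℝ)
  have hΔ0 : 0 ≤ Δ := Nat.cast_nonneg _
  have hj0 : (0 : ℝ) ≤ J.card := Nat.cast_nonneg _
  have hpos : ∀ v, 0 < (H n).degree v := fun v => by
    have : (0 : ℝ) < (H n).degree v := lt_of_lt_of_le (by positivity) (hdeg v).1
    exact_mod_cast this
  let s : Fin n → ℝ := fun w => ∑ u ∈ J, callProb (H n) q u w
  have hs0 : ∀ w, 0 ≤ s w := fun w => Finset.sum_nonneg fun u _ => callProb_nonneg _ _ _ _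
  have hs : ∀ w, s w ≤ (δ / 2)⁻¹ * degInto (G n) J w := fun w =>
    sum_callProb_le q (by positivity) (fun v => (hdeg v).1) (hH n).le J w
  have hsmall : (J.card : ℝ) ^ 2 / n + ξ / 24 * J.card ≤ ξ / 12 * J.card := by
    have : (J.card : ℝ) ^ 2 / n ≤ ξ / 24 * J.card := by
      rw [div_le_iff₀ hn0]; nlinarith
    linarith
  have hr : (δ / 2)⁻¹ * Δ ≤ 3 := by
    rw [inv_mul_le_iff₀ (by positivity)]; linarith
  have hr0 : 0 ≤ (δ / 2)⁻¹ * Δ := by positivity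
  have hin : ∑ w ∈ J, s w ≤ 3 * (ξ / 12 * J.card) := by
    calc _ ≤ ∑ w ∈ J, (δ / 2)⁻¹ * degInto (G n) J w := Finset.sum_le_sum fun w _ => hs w
      _ = (δ / 2)⁻¹ * ∑ w ∈ J, degInto (G n) J w := (Finset.mul_sum _ _ _).symm
      _ ≤ (δ / 2)⁻¹ * (Δ * (ξ / 12 * J.card)) := by
          gcongr
          exact (hmix J).1.trans (mul_le_mul_of_nonneg_left hsmall hΔ0)
      _ = ((δ / 2)⁻¹ * Δ) * (ξ / 12 * J.card) := by ring
      _ ≤ _ := by gcongr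
  have hsq : ∑ w, s w ^ 2 ≤ 9 * (ξ / 12 * J.card) := by
    calc _ ≤ ∑ w, ((δ / 2)⁻¹ * degInto (G n) J w) ^ 2 := Finset.sum_le_sum fun w _ => by
            have := hs0 w
            gcongr
            exact hs w
      _ = (δ / 2)⁻¹ ^ 2 * ∑ w, degInto (G n) J w ^ 2 := by
          rw [Finset.mul_sum]; exact Finset.sum_congr rfl fun w _ => by ring
      _ ≤ (δ / 2)⁻¹ ^ 2 * (Δ ^ 2 * (ξ / 12 * J.card)) := by
          gcongr
          exact (hmix J).2.trans (mul_le_mul_of_nonneg_left hsmall (sq_nonneg Δ))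
      _ = ((δ / 2)⁻¹ * Δ) ^ 2 * (ξ / 12 * J.card) := by ring
      _ ≤ 3 ^ 2 * (ξ / 12 * J.card) := by gcongr
      _ = _ := by norm_num
  have htot : ∑ w, s w = q * J.card := by
    simp only [s]
    rw [Finset.sum_comm, Finset.sum_congr rfl fun u _ => sum_univ_callProb q (hpos u)]
    simp [mul_comm]
  have hgain : ∑ w ∈ Jᶜ, (s w - s w ^ 2) ≤ expectedGain (H n) q false (fun _ => 1) J := by
    refine Finset.sum_le_sum fun w hw => ?_
    rw [one_mul]
    refine (sub_sq_le_div_one_add (hs0 w)).trans ?_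
    have := le_informProb (H n) q (pull := false) (Finset.mem_compl.1 hw)
    rwa [contactRate_push] at this
  have hsplit := Finset.sum_add_sum_compl J s
  have hsq' : ∑ w ∈ Jᶜ, s w ^ 2 ≤ ∑ w, s w ^ 2 :=
    Finset.sum_le_sum_of_subset_of_nonneg (Finset.subset_univ _) fun w _ _ => sq_nonneg _
  rw [Finset.sum_sub_distrib] at hgain
  linarith

end Sequence

/-! ### The weight for push&pull -/

section Weight

open Matrix

variable {n : ℕ} (H : SimpleGraph (Fin n)) [DecidableRel H.Adj]

/-- The symmetric matrix `D⁻¹ A + A D⁻¹` of the rates of push&pull. -/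
noncomputable def rateMatrix : Matrix (Fin n) (Fin n) ℝ :=
  fun u w => if H.Adj u w then (H.degree u : ℝ)⁻¹ + (H.degree w : ℝ)⁻¹ else 0

lemma rateMatrix_nonneg (u w : Fin n) : 0 ≤ rateMatrix H u w := by
  unfold rateMatrix; split_ifs <;> positivity

lemma rateMatrix_comm (u w : Fin n) : rateMatrix H u w = rateMatrix H w u := by
  simp only [rateMatrix, H.adj_comm u w, add_comm]

lemma isHermitian_rateMatrix : (rateMatrix H).IsHermitian := by
  ext u w
  simp [rateMatrix_comm H w u]

variable {H}

lemma sum_rateMatrix (hpos : ∀ v, 0 < H.degree v) : ∑ u, ∑ w, rateMatrix H u w = 2 * n := by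
  have h1 : ∑ u, ∑ w, (H.degree u : ℝ)⁻¹ * (if H.Adj u w then 1 else 0) = n := by
    simp_rw [← Finset.mul_sum]
    have : ∀ u, (H.degree u : ℝ)⁻¹ * ∑ w, (if H.Adj u w then (1 : ℝ) else 0) = 1 := fun u => by
      change _ * degInto H Finset.univ u = 1
      rw [degInto_univ]
      exact inv_mul_cancel₀ (by exact_mod_cast (hpos u).ne')
    rw [Finset.sum_congr rfl fun u _ => this u]
    simp
  have h2 : ∀ u w, rateMatrix H u w = (H.degree u : ℝ)⁻¹ * (if H.Adj u w then 1 else 0) +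
      (H.degree w : ℝ)⁻¹ * (if H.Adj w u then 1 else 0) := fun u w => by
    simp only [rateMatrix, H.adj_comm w u]
    split_ifs <;> simp
  simp_rw [h2, Finset.sum_add_distrib]
  rw [h1, Finset.sum_comm, h1]
  ring

/-- The Rayleigh quotient of the constant vector is `2`, so some eigenvalue is at least `2`; as the
matrix is nonnegative, passing to absolute values in the eigenvector equation only increases the
right side. -/
lemma exists_subsolution (hn : 0 < n) (hpos : ∀ v, 0 < H.degree v) :
    ∃ x : Fin n → ℝ, (∀ w, 0 ≤ x w) ∧ 0 < ∑ w, x w ∧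
      ∀ w, 2 * x w ≤ (rateMatrix H *ᵥ x) w := by
  set hM := isHermitian_rateMatrix H
  obtain ⟨i, hi⟩ : ∃ i, 2 ≤ hM.eigenvalues i := by
    by_contra! hlt
    set c : Fin n → ℝ := fun i => ⇑(hM.eigenvectorBasis i) ⬝ᵥ (1 : Fin n → ℝ) with hc
    have h1 : ∑ i, hM.eigenvalues i * c i ^ 2 = 2 * n := by
      rw [← dotProduct_mulVec_eq_sum hM, ← sum_rateMatrix hpos]
      simp [dotProduct, mulVec]
    have h2 : ∑ i, c i ^ 2 = n := by
      have := dotProduct_eq_sum_eigenvectorBasis hM 1 1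
      simp_rw [← sq] at this
      rw [← this]
      simp
    have h3 : ∑ i, (2 - hM.eigenvalues i) * c i ^ 2 = 0 := by
      simp_rw [sub_mul]
      rw [Finset.sum_sub_distrib, ← Finset.mul_sum, h1, h2, sub_self]
    rw [Finset.sum_eq_zero_iff_of_nonneg fun i _ =>
      mul_nonneg (sub_nonneg.2 (hlt i).le) (sq_nonneg _)] at h3
    have h4 : ∀ i, c i ^ 2 = 0 := fun i =>
      (mul_eq_zero.1 (h3 i (Finset.mem_univ i))).resolve_left (sub_pos.2 (hlt i)).ne'
    simp only [h4, Finset.sum_const_zero] at h2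
    have : (0 : ℝ) < n := by exact_mod_cast hn
    linarith
  set e : Fin n → ℝ := ⇑(hM.eigenvectorBasis i) with he
  refine ⟨fun w => |e w|, fun w => abs_nonneg _, ?_, fun w => ?_⟩
  · refine lt_of_le_of_ne (Finset.sum_nonneg fun _ _ => abs_nonneg _) fun h => ?_
    have h0 := (Finset.sum_eq_zero_iff_of_nonneg fun _ _ => abs_nonneg _).1 h.symm
    have h1 := eigenvector_dotProduct_self hM i
    rw [show (⇑(hM.eigenvectorBasis i) : Fin n → ℝ) = 0 from
      funext fun w => abs_eq_zero.1 (h0 w (Finset.mem_univ w))] at h1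
    simp at h1
  · have h1 : hM.eigenvalues i * e w = ∑ u, rateMatrix H w u * e u :=
      (congrFun (eigenvector_mulVec hM i) w).symm
    calc 2 * |e w| ≤ hM.eigenvalues i * |e w| := by gcongr
      _ = |hM.eigenvalues i * e w| := by rw [abs_mul, abs_of_nonneg (by linarith : 0 ≤ hM.eigenvalues i)]
      _ ≤ ∑ u, |rateMatrix H w u * e u| := by rw [h1]; exact Finset.abs_sum_le_sum_abs _ _
      _ = _ := Finset.sum_congr rfl fun u _ => by
          rw [abs_mul, abs_of_nonneg (rateMatrix_nonneg H w u)]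

/-- One step of smoothing a weight. -/
noncomputable def smooth (H : SimpleGraph (Fin n)) [DecidableRel H.Adj] (x : Fin n → ℝ) :
    Fin n → ℝ := fun w => x w + (rateMatrix H *ᵥ x) w

lemma rateMatrix_mulVec_apply (x : Fin n → ℝ) (w : Fin n) :
    (rateMatrix H *ᵥ x) w = ∑ u, rateMatrix H w u * x u := rfl

lemma rateMatrix_mulVec_mono {x y : Fin n → ℝ} (h : ∀ w, x w ≤ y w) (w : Fin n) :
    (rateMatrix H *ᵥ x) w ≤ (rateMatrix H *ᵥ y) w := by
  rw [rateMatrix_mulVec_apply, rateMatrix_mulVec_apply]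
  exact Finset.sum_le_sum fun u _ => mul_le_mul_of_nonneg_left (h u) (rateMatrix_nonneg H w u)

/-- Smoothing is `1 + M`, which commutes with `M` and preserves inequalities between weights. -/
lemma smooth_subsolution {x : Fin n → ℝ} (h : ∀ w, 2 * x w ≤ (rateMatrix H *ᵥ x) w) (w : Fin n) :
    2 * smooth H x w ≤ (rateMatrix H *ᵥ smooth H x) w := by
  have h1 : rateMatrix H *ᵥ smooth H x =
      rateMatrix H *ᵥ x + rateMatrix H *ᵥ (rateMatrix H *ᵥ x) := by
    rw [← mulVec_add]; rfl
  have h2 := rateMatrix_mulVec_mono (H := H) h w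
  have h3 : (rateMatrix H *ᵥ fun w => 2 * x w) w = 2 * (rateMatrix H *ᵥ x) w := by
    rw [← smul_eq_mul, ← Pi.smul_apply, ← mulVec_smul]; rfl
  rw [h3] at h2
  rw [h1, Pi.add_apply, smooth]
  linarith [h w]

variable {α : ℝ}

lemma rateMatrix_le (hα : 0 < α) (hn : 0 < n) (hdeg : ∀ v, α * n / 2 ≤ (H.degree v : ℝ))
    (u w : Fin n) : rateMatrix H u w ≤ 4 / (α * n) := by
  have hn0 : (0 : ℝ) < n := by exact_mod_cast hn
  have h : ∀ v, (H.degree v : ℝ)⁻¹ ≤ 2 / (α * n) := fun v => by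
    rw [← inv_div]
    exact inv_anti₀ (by positivity) (hdeg v)
  unfold rateMatrix
  split_ifs
  · calc _ ≤ 2 / (α * n) + 2 / (α * n) := add_le_add (h u) (h w)
      _ = _ := by ring
  · positivity

/-- Density makes all entries `O(1 / n)`, so one application of the matrix bounds the maximum by the
mean. -/
lemma rateMatrix_mulVec_le (hα : 0 < α) (hn : 0 < n)
    (hdeg : ∀ v, α * n / 2 ≤ (H.degree v : ℝ)) {x : Fin n → ℝ} (hx : ∀ w, 0 ≤ x w) (w : Fin n) :
    (rateMatrix H *ᵥ x) w ≤ 4 / (α * n) * ∑ u, x u := by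
  rw [Finset.mul_sum, rateMatrix_mulVec_apply]
  exact Finset.sum_le_sum fun u _ =>
    mul_le_mul_of_nonneg_right (rateMatrix_le hα hn hdeg w u) (hx u)

lemma le_rateMatrix_mulVec (hpos : ∀ v, 0 < H.degree v) {x : Fin n → ℝ} (hx : ∀ w, 0 ≤ x w) {τ : ℝ}
    (hτ : 0 ≤ τ) {S : Finset (Fin n)} (hS : ∀ u ∈ S, τ ≤ x u) (w : Fin n) :
    τ / n * degInto H S w ≤ (rateMatrix H *ᵥ x) w := by
  calc τ / n * degInto H S w = ∑ u ∈ S, τ / n * (if H.Adj w u then 1 else 0) := by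
        rw [degInto, Finset.mul_sum]
    _ ≤ ∑ u ∈ S, rateMatrix H w u * x u := Finset.sum_le_sum fun u hu => by
        unfold rateMatrix
        split_ifs
        · have h1 : (H.degree u : ℝ) ≤ n := by
            have := (H.degree_lt_card_verts u).le
            rw [Fintype.card_fin] at this
            exact_mod_cast this
          have h0 : (0 : ℝ) < H.degree u := by exact_mod_cast hpos u
          have h2 : (n : ℝ)⁻¹ ≤ (H.degree u : ℝ)⁻¹ := inv_anti₀ h0 h1
          have h3 : (0 : ℝ) ≤ (H.degree w : ℝ)⁻¹ := by positivity
          rw [mul_one, div_eq_mul_inv, mul_comm]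
          exact mul_le_mul (by linarith) (hS u hu) hτ (by positivity)
        · simp
    _ ≤ _ := Finset.sum_le_sum_of_subset_of_nonneg (Finset.subset_univ S) fun u _ _ =>
        mul_nonneg (rateMatrix_nonneg H w u) (hx u)

variable {ε β : ℝ}

/-- A set of linear size has linearly many further vertices with linearly many neighbours in it,
unless all vertices have this property. -/
lemma exists_spread (hn : 0 < n) (hε : 0 < ε) (hε₁ : ε ≤ 1 / 2) (hα : 0 < α)
    (hα₁ : α ≤ 1) (hβ : β = ε * α ^ 2 / 16) (hdeg : ∀ v, α * n / 2 ≤ (H.degree v : ℝ))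
    (hcut : ∀ S : Finset (Fin n), ε / 2 * (α * n) * min (S.card : ℝ) (Sᶜ.card : ℝ) ≤
      ∑ w ∈ Sᶜ, degInto H S w)
    {S : Finset (Fin n)} (hS : α / 4 * n ≤ S.card) :
    ∃ T : Finset (Fin n), S ⊆ T ∧ (∀ w ∈ T, w ∈ S ∨ β * n ≤ degInto H S w) ∧
      (T = Finset.univ ∨ S.card + β * n ≤ (T.card : ℝ)) := by
  classical
  have hn0 : (0 : ℝ) < n := by exact_mod_cast hn
  have hβ0 : 0 < β := by rw [hβ]; positivity
  have hβα : β ≤ α / 4 := by rw [hβ]; nlinarith [mul_nonneg hε.le hα.le]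
  -- If few vertices are missing, every vertex retains at least `α n / 2 - α n / 4 ≥ β n` neighbours
  -- in `S`.
  by_cases hsmall : (Sᶜ.card : ℝ) < α / 4 * n
  · refine ⟨Finset.univ, Finset.subset_univ _, fun w _ => Or.inr ?_, Or.inl rfl⟩
    have h1 := degInto_add_compl (H := H) S w
    have h2 := degInto_le_card (H := H) Sᶜ w
    have h3 := hdeg w
    have h4 := mul_le_mul_of_nonneg_right hβα hn0.le
    linarith
  · set N := Sᶜ.filter fun w => β * n ≤ degInto H S w with hN
    have hdisj : Disjoint S N := Finset.disjoint_left.2 fun w hw hw' =>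
      Finset.mem_compl.1 (Finset.mem_filter.1 hw').1 hw
    refine ⟨S ∪ N, Finset.subset_union_left, fun w hw => ?_, Or.inr ?_⟩
    · rcases Finset.mem_union.1 hw with h | h
      · exact Or.inl h
      · exact Or.inr (Finset.mem_filter.1 h).2
    · rw [Finset.card_union_of_disjoint hdisj]
      push_cast
      have h1 : ε / 2 * (α * n) * (α / 4 * n) ≤ ∑ w ∈ Sᶜ, degInto H S w :=
        (mul_le_mul_of_nonneg_left (le_min hS (not_lt.1 hsmall)) (by positivity)).trans (hcut S)
      have h2 : ∑ w ∈ Sᶜ, degInto H S w ≤ n * N.card + β * n * n := by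
        rw [← Finset.sum_filter_add_sum_filter_not Sᶜ fun w => β * n ≤ degInto H S w]
        refine add_le_add ?_ ?_
        · calc _ ≤ ∑ _w ∈ N, (n : ℝ) := Finset.sum_le_sum fun w _ =>
                (degInto_le_card S w).trans (by
                  have := Finset.card_le_univ S
                  rw [Fintype.card_fin] at this
                  exact_mod_cast this)
            _ = _ := by simp [mul_comm]
        · calc _ ≤ ∑ _w ∈ Sᶜ.filter fun w => ¬ β * n ≤ degInto H S w, β * n :=
                Finset.sum_le_sum fun w hw => (not_le.1 (Finset.mem_filter.1 hw).2).le
            _ = (Sᶜ.filter fun w => ¬ β * n ≤ degInto H S w).card * (β * n) := by simp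
            _ ≤ n * (β * n) := by
                gcongr
                have := Finset.card_le_univ (Sᶜ.filter fun w => ¬ β * n ≤ degInto H S w)
                rwa [Fintype.card_fin] at this
            _ = _ := by ring
      -- `β` is chosen so that the cut has at least `2 β n²` edges; vertices outside `N` account for
      -- at most `β n²`, and each vertex of `N` for at most `n`.
      have h3 : ε / 2 * (α * n) * (α / 4 * n) = 2 * (β * n) * n := by rw [hβ]; ring
      have h4 : β * n * n ≤ N.card * n := by linarith
      linarith [le_of_mul_le_mul_right h4 hn0]

/-- In a dense graph with positive cuts there is a weight, bounded from above and below, that grows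
by a factor `2` under the rate matrix. -/
theorem exists_weight (hn : 0 < n) (hε : 0 < ε) (hε₁ : ε ≤ 1 / 2) (hα : 0 < α)
    (hα₁ : α ≤ 1) (hβ : β = ε * α ^ 2 / 16) (hdeg : ∀ v, α * n / 2 ≤ (H.degree v : ℝ))
    (hcut : ∀ S : Finset (Fin n), ε / 2 * (α * n) * min (S.card : ℝ) (Sᶜ.card : ℝ) ≤
      ∑ w ∈ Sᶜ, degInto H S w) :
    ∃ φ : Fin n → ℝ, (∀ w, β ^ ⌈β⁻¹⌉₊ / 2 ≤ φ w) ∧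
      (∀ w, φ w ≤ (1 + 4 / α) ^ ⌈β⁻¹⌉₊ * (2 / α)) ∧
      ∀ w, 2 * φ w ≤ (rateMatrix H *ᵥ φ) w := by
  have hn0 : (0 : ℝ) < n := by exact_mod_cast hn
  have hβ0 : 0 < β := by rw [hβ]; positivity
  have hβ1 : β ≤ 1 := by rw [hβ]; nlinarith [mul_nonneg hε.le hα.le]
  have hpos : ∀ v, 0 < H.degree v := fun v => by
    have : (0 : ℝ) < H.degree v := lt_of_lt_of_le (by positivity) (hdeg v)
    exact_mod_cast this
  obtain ⟨x₀, hx₀, hsum₀, hsub₀⟩ := exists_subsolution hn hpos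
  obtain ⟨x, hx, hsum, hsub⟩ : ∃ x : Fin n → ℝ, (∀ w, 0 ≤ x w) ∧ ∑ w, x w = n ∧
      ∀ w, 2 * x w ≤ (rateMatrix H *ᵥ x) w := by
    set r := (n : ℝ) / ∑ w, x₀ w with hr
    have hr0 : 0 < r := by positivity
    refine ⟨r • x₀, fun w => mul_nonneg hr0.le (hx₀ w), ?_, fun w => ?_⟩
    · simp only [Pi.smul_apply, smul_eq_mul, ← Finset.mul_sum]
      rw [hr]; field_simp
    · rw [mulVec_smul, Pi.smul_apply, Pi.smul_apply, smul_eq_mul, smul_eq_mul]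
      have := mul_le_mul_of_nonneg_left (hsub₀ w) hr0.le
      linarith
  have hxb : ∀ w, x w ≤ 2 / α := fun w => by
    have h1 := (hsub w).trans (rateMatrix_mulVec_le hα hn hdeg hx w)
    rw [hsum] at h1
    have h2 : 4 / (α * n) * n = 2 * (2 / α) := by field_simp; norm_num
    linarith
  -- After `k` smoothings the weight is at least `β ^ k / 2` on a set `S`. Averaging gives the
  -- initial `α n / 4` vertices, and each further smoothing adds `β n` vertices until `S` is
  -- everything. The upper bound grows by a constant factor per step.
  have hiter : ∀ k : ℕ, (∀ w, 0 ≤ (smooth H)^[k] x w) ∧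
      (∀ w, (smooth H)^[k] x w ≤ (1 + 4 / α) ^ k * (2 / α)) ∧
      (∀ w, 2 * (smooth H)^[k] x w ≤ (rateMatrix H *ᵥ (smooth H)^[k] x) w) ∧
      ∃ S : Finset (Fin n), (∀ w ∈ S, β ^ k / 2 ≤ (smooth H)^[k] x w) ∧
        α / 4 * n ≤ S.card ∧ (S = Finset.univ ∨ α / 4 * n + k * β * n ≤ S.card) := by
    intro k
    induction k with
    | zero =>
      refine ⟨hx, by simpa using hxb, hsub, ?_⟩
      have hS : α / 4 * n ≤ (Finset.univ.filter fun w => 1 / 2 ≤ x w).card := by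
        have h1 : ∑ w, x w ≤
            2 / α * (Finset.univ.filter fun w => 1 / 2 ≤ x w).card + 1 / 2 * n := by
          rw [← Finset.sum_filter_add_sum_filter_not Finset.univ fun w => 1 / 2 ≤ x w]
          refine add_le_add ?_ ?_
          · calc _ ≤ ∑ _w ∈ Finset.univ.filter fun w => 1 / 2 ≤ x w, 2 / α :=
                  Finset.sum_le_sum fun w _ => hxb w
              _ = _ := by simp [mul_comm]
          · calc _ ≤ ∑ _w ∈ Finset.univ.filter fun w => ¬ 1 / 2 ≤ x w, (1 / 2 : ℝ) :=
                  Finset.sum_le_sum fun w hw => (not_le.1 (Finset.mem_filter.1 hw).2).le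
              _ = (Finset.univ.filter fun w => ¬ 1 / 2 ≤ x w).card * (1 / 2 : ℝ) := by simp
              _ ≤ n * (1 / 2) := by
                  gcongr
                  have := Finset.card_le_univ (Finset.univ.filter fun w => ¬ 1 / 2 ≤ x w)
                  rwa [Fintype.card_fin] at this
              _ = _ := by ring
        rw [hsum] at h1
        have h2 : (n : ℝ) / 2 ≤ 2 / α * (Finset.univ.filter fun w => 1 / 2 ≤ x w).card := by
          linarith
        rw [div_mul_eq_mul_div, le_div_iff₀ hα] at h2
        linarith
      refine ⟨Finset.univ.filter fun w => 1 / 2 ≤ x w, fun w hw => ?_, hS, Or.inr ?_⟩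
      · simpa using (Finset.mem_filter.1 hw).2
      · simpa using hS
    | succ k ih =>
      obtain ⟨ih0, ihb, ihs, S, hSy, hSc, hSu⟩ := ih
      set y := (smooth H)^[k] x with hy
      rw [Function.iterate_succ_apply', ← hy]
      have hMy : ∀ w, 0 ≤ (rateMatrix H *ᵥ y) w := fun w => by
        rw [rateMatrix_mulVec_apply]
        exact Finset.sum_nonneg fun u _ => mul_nonneg (rateMatrix_nonneg H w u) (ih0 u)
      refine ⟨fun w => add_nonneg (ih0 w) (hMy w), fun w => ?_, smooth_subsolution ihs, ?_⟩
      · have h1 := rateMatrix_mulVec_le hα hn hdeg ih0 w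
        have h2 : ∑ u, y u ≤ n * ((1 + 4 / α) ^ k * (2 / α)) := by
          calc _ ≤ ∑ _u : Fin n, (1 + 4 / α) ^ k * (2 / α) := Finset.sum_le_sum fun u _ => ihb u
            _ = _ := by simp
        have h3 : 4 / (α * n) * ∑ u, y u ≤ 4 / (α * n) * (n * ((1 + 4 / α) ^ k * (2 / α))) := by
          gcongr
        have h4 : 4 / (α * n) * (n * ((1 + 4 / α) ^ k * (2 / α))) =
            4 / α * ((1 + 4 / α) ^ k * (2 / α)) := by
          generalize (1 + 4 / α) ^ k = z
          field_simp
        have h5 : (1 + 4 / α) ^ (k + 1) * (2 / α) = (1 + 4 / α) ^ k * (2 / α) +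
            4 / α * ((1 + 4 / α) ^ k * (2 / α)) := by ring
        rw [h5, smooth]
        linarith [ihb w]
      · obtain ⟨T, hST, hT, hTc⟩ := exists_spread hn hε hε₁ hα hα₁ hβ hdeg hcut hSc
        have hcard : (S.card : ℝ) ≤ T.card := by exact_mod_cast Finset.card_le_card hST
        refine ⟨T, fun w hw => ?_, hSc.trans hcard, ?_⟩
        · have hβk : 0 < β ^ k / 2 := by positivity
          have hle : β ^ (k + 1) / 2 = β * (β ^ k / 2) := by ring
          rw [hle, smooth]
          rcases hT w hw with h | h
          · have := hSy w h
            have := mul_le_of_le_one_left hβk.le hβ1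
            linarith [hMy w]
          · have h1 := le_rateMatrix_mulVec hpos ih0 hβk.le hSy w
            have h2 : β ^ k / 2 / n * (β * n) ≤ β ^ k / 2 / n * degInto H S w := by gcongr
            have h3 : β ^ k / 2 / n * (β * n) = β * (β ^ k / 2) := by field_simp
            linarith [ih0 w]
        · rcases hTc with h | h
          · exact Or.inl h
          · rcases hSu with h' | h'
            · left
              rw [h'] at hST
              exact Finset.univ_subset_iff.1 hST
            · right
              push_cast
              linarith
  obtain ⟨-, hb, hs, S, hS, -, hSu⟩ := hiter ⌈β⁻¹⌉₊
  refine ⟨_, fun w => hS w ?_, hb, hs⟩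
  rcases hSu with rfl | h
  · exact Finset.mem_univ w
  · exfalso
    -- After `⌈β⁻¹⌉₊` steps a set that is not everything would have more than `n` vertices.
    have h1 : (1 : ℝ) ≤ ⌈β⁻¹⌉₊ * β := by
      have := mul_le_mul_of_nonneg_right (Nat.le_ceil β⁻¹) hβ0.le
      rwa [inv_mul_cancel₀ hβ0.ne'] at this
    have h2 : (S.card : ℝ) ≤ n := by
      have := Finset.card_le_univ S
      rw [Fintype.card_fin] at this
      exact_mod_cast this
    have h3 := mul_le_mul_of_nonneg_right h1 hn0.le
    have h4 : 0 < α / 4 * n := by positivity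
    linarith

lemma contactRate_pushPull (q : unitInterval) (hpos : ∀ v, 0 < H.degree v) (J : Finset (Fin n))
    (w : Fin n) : contactRate H q true J w = q * ∑ u ∈ J, rateMatrix H w u := by
  rw [contactRate, if_pos rfl, ← Finset.sum_add_distrib, Finset.mul_sum]
  refine Finset.sum_congr rfl fun u _ => ?_
  rw [callProb_eq q (hpos u), callProb_eq q (hpos w)]
  simp only [rateMatrix, H.adj_comm u w]
  split_ifs
  · ring
  · simp

/-- Growth of small informed sets in push&pull with respect to a subsolution. -/
lemma le_expectedGain_pushPull (q : unitInterval) (hα : 0 < α) (hn : 0 < n)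
    (hdeg : ∀ v, α * n / 2 ≤ (H.degree v : ℝ)) {φ : Fin n → ℝ} (hφ : ∀ w, 0 ≤ φ w)
    (hsub : ∀ w, 2 * φ w ≤ (rateMatrix H *ᵥ φ) w) {ξ : ℝ} (hξ : 0 < ξ) {J : Finset (Fin n)}
    (hJ : (J.card : ℝ) ≤ ξ * α / 12 * n) :
    (2 * q - ξ) * ∑ w ∈ J, φ w ≤ expectedGain H q true φ J := by
  have hn0 : (0 : ℝ) < n := by exact_mod_cast hn
  have hq0 : (0 : ℝ) ≤ q := q.2.1
  have hq1 : (q : ℝ) ≤ 1 := q.2.2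
  have hpos : ∀ v, 0 < H.degree v := fun v => by
    have : (0 : ℝ) < H.degree v := lt_of_lt_of_le (by positivity) (hdeg v)
    exact_mod_cast this
  set s : Fin n → ℝ := contactRate H q true J with hs
  have hs0 : ∀ w, 0 ≤ s w := contactRate_nonneg H q true J
  have hsz : ∀ w, s w ≤ ξ / 3 := fun w => by
    rw [hs, contactRate_pushPull q hpos]
    calc _ ≤ 1 * ∑ u ∈ J, rateMatrix H w u := by
          gcongr
          exact Finset.sum_nonneg fun u _ => rateMatrix_nonneg H w u
      _ ≤ 1 * ∑ _u ∈ J, 4 / (α * n) := by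
          gcongr
          exact rateMatrix_le hα hn hdeg _ _
      _ = J.card * (4 / (α * n)) := by simp
      _ ≤ ξ * α / 12 * n * (4 / (α * n)) := by gcongr
      _ = ξ / 3 := by field_simp; norm_num
  have hΦ : 0 ≤ ∑ w ∈ J, φ w := Finset.sum_nonneg fun w _ => hφ w
  have htot : 2 * q * ∑ w ∈ J, φ w ≤ ∑ w, φ w * s w := by
    calc 2 * q * ∑ w ∈ J, φ w = q * ∑ u ∈ J, 2 * φ u := by rw [← Finset.mul_sum]; ring
      _ ≤ q * ∑ u ∈ J, (rateMatrix H *ᵥ φ) u := by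
          gcongr
          exact hsub _
      -- Symmetry of the rate matrix moves it from the weight to the indicator of `J`.
      _ = ∑ w, φ w * s w := by
          simp only [hs, contactRate_pushPull q hpos, mulVec, dotProduct]
          rw [Finset.sum_comm, Finset.mul_sum]
          refine Finset.sum_congr rfl fun w _ => ?_
          rw [← Finset.sum_mul, Finset.sum_congr rfl fun u _ => rateMatrix_comm H u w]
          ring
  have hin : ∑ w ∈ J, φ w * s w ≤ ξ / 3 * ∑ w ∈ J, φ w := by
    rw [Finset.mul_sum]
    exact Finset.sum_le_sum fun w _ => by
      rw [mul_comm]; exact mul_le_mul_of_nonneg_right (hsz w) (hφ w)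
  have hsplit := Finset.sum_add_sum_compl J fun w => φ w * s w
  have hgain : (∑ w ∈ Jᶜ, φ w * s w) / (1 + ξ / 3) ≤ expectedGain H q true φ J := by
    rw [Finset.sum_div]
    refine Finset.sum_le_sum fun w hw => ?_
    rw [mul_div_assoc]
    refine mul_le_mul_of_nonneg_left (le_trans ?_ (le_informProb H q (Finset.mem_compl.1 hw)))
      (hφ w)
    exact div_le_div_of_nonneg_left (hs0 w) (by linarith [hs0 w]) (by linarith [hsz w])
  refine le_trans ?_ hgain
  rw [le_div_iff₀ (by positivity)]
  -- The right side allows for the rate lost inside `J`, the factor `1 + ξ / 3` for saturation; `q ≤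
  -- 1` makes both fit into `ξ`.
  have h1 : (2 * q - ξ) * (1 + ξ / 3) ≤ 2 * q - ξ / 3 := by nlinarith
  have h2 := mul_le_mul_of_nonneg_right h1 hΦ
  linarith

end Weight

/-! ### The lower bound for push -/

section LowerBound

variable {n : ℕ} {H : SimpleGraph (Fin n)} [DecidableRel H.Adj] (q : unitInterval)

lemma expectedGain_push_le (hpos : ∀ v, 0 < H.degree v) (J : Finset (Fin n)) :
    expectedGain H q false (fun _ => 1) J ≤ q * J.card := by
  calc expectedGain H q false (fun _ => 1) J ≤ ∑ w ∈ Jᶜ, ∑ u ∈ J, callProb H q u w :=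
        Finset.sum_le_sum fun w hw => by
          rw [one_mul]; exact informProb_push_le H q (Finset.mem_compl.1 hw)
    _ ≤ ∑ w, ∑ u ∈ J, callProb H q u w :=
        Finset.sum_le_sum_of_subset_of_nonneg (Finset.subset_univ _) fun w _ _ =>
          Finset.sum_nonneg fun u _ => callProb_nonneg H q u w
    _ = ∑ u ∈ J, (q : ℝ) := by
        rw [Finset.sum_comm]
        exact Finset.sum_congr rfl fun u _ => sum_univ_callProb q (hpos u)
    _ = _ := by simp [mul_comm]

/-- Push at most multiplies the expected number of informed vertices by `1 + q` per round. -/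
lemma failProb_push_compl_le (hpos : ∀ v, 0 < H.degree v) {m : ℝ} (hm : 0 < m) (t : ℕ)
    (v : Fin n) :
    failProb H q false (largeSets n m)ᶜ t {v} ≤ m⁻¹ * (1 + q) ^ t := by
  have hq0 : (0 : ℝ) ≤ q := q.2.1
  have h1 : ∀ J : Finset (Fin n), {v} ⊆ J →
      transition H q false (fun J => (J.card : ℝ)) J ≤ (1 + q) * J.card := fun J _ => by
    have h := transition_sum (G := H) (q := q) (pull := false) (φ := fun _ => 1) (I := J)
    simp only [Finset.sum_const, nsmul_eq_mul, mul_one] at h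
    rw [h]
    linarith [expectedGain_push_le q hpos J]
  have h2 := iterate_transition_le (by positivity) h1 t
  have h3 : failProb H q false (largeSets n m)ᶜ t {v} ≤
      (transition H q false)^[t] (fun J => m⁻¹ * (J.card : ℝ)) {v} := by
    refine iterate_transition_mono t fun J _ => ?_
    by_cases hJ : J ∈ largeSets n m
    · have h4 : m ≤ (J.card : ℝ) := hJ
      have h5 : (1 : ℝ) ≤ m⁻¹ * J.card := by
        rw [inv_mul_eq_div, one_le_div hm]; exact h4
      simpa [hJ] using h5
    · have h5 : (0 : ℝ) ≤ m⁻¹ * J.card := by positivity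
      simpa [hJ] using h5
  rw [iterate_transition_const_mul] at h3
  refine h3.trans (mul_le_mul_of_nonneg_left ?_ (by positivity))
  simpa using h2

end LowerBound

lemma eventually_push_early_le (H : (n : ℕ) → SimpleGraph (Fin n)) [∀ n, DecidableRel (H n).Adj]
    {q : unitInterval} (hq : 0 < q) (hpos : ∀ᶠ n in atTop, ∀ v, 0 < (H n).degree v) {κ η : ℝ}
    (hκ : 0 < κ) (hη : 0 < η) :
    ∀ᶠ n : ℕ in atTop, ∀ v : Fin n,
      failProb (H n) q false (largeSets n (n - n / Real.log n))ᶜ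
        ⌊Real.logb (1 + q) n - κ * Real.log n⌋₊ {v} ≤ η := by
  have hq0 : (0 : ℝ) < q := hq
  set l := Real.log (1 + q) with hl
  have hl0 : 0 < l := Real.log_pos (by linarith)
  have hLt : Tendsto (fun n : ℕ => Real.log n) atTop atTop :=
    Real.tendsto_log_atTop.comp tendsto_natCast_atTop_atTop
  have hlim : Tendsto (fun n : ℕ => 2 * (n : ℝ)⁻¹ + 2 * Real.exp (-(l * κ * Real.log n))) atTop
      (𝓝 0) := by
    have h1 := (tendsto_inv_atTop_zero.comp (tendsto_natCast_atTop_atTop (R := ℝ))).const_mul 2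
    have h2 := (Real.tendsto_exp_neg_atTop_nhds_zero.comp
      (hLt.const_mul_atTop (mul_pos hl0 hκ))).const_mul 2
    simpa using h1.add h2
  filter_upwards [hlim.eventually_le_const hη, hpos, hLt.eventually_ge_atTop 2,
    eventually_gt_atTop 0] with n hle hpos hL hn v
  have hn0 : (0 : ℝ) < n := by exact_mod_cast hn
  have hm : (n : ℝ) / 2 ≤ n - n / Real.log n := by
    have : (n : ℝ) / Real.log n ≤ n / 2 := div_le_div_of_nonneg_left hn0.le (by norm_num) hL
    linarith
  refine (failProb_push_compl_le q hpos (lt_of_lt_of_le (by positivity) hm) _ v).trans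
    (le_trans ?_ hle)
  set y := Real.logb (1 + q) n - κ * Real.log n with hy
  -- The summand `1` covers `y < 0`, where the floor is truncated to `0`.
  have hpow : (1 + (q : ℝ)) ^ ⌊y⌋₊ ≤ 1 + n * Real.exp (-(l * κ * Real.log n)) := by
    have hexp : Real.exp (l * y) = n * Real.exp (-(l * κ * Real.log n)) := by
      have : l * y = Real.log n + -(l * κ * Real.log n) := by
        rw [hy, Real.logb, ← hl]; field_simp; ring
      rw [this, Real.exp_add, Real.exp_log hn0]
    rw [← hexp]
    rcases le_or_gt 0 y with h | h
    · have h1 : (1 + (q : ℝ)) ^ ⌊y⌋₊ = Real.exp (l * ⌊y⌋₊) := by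
        rw [← Real.rpow_natCast, Real.rpow_def_of_pos (by linarith)]
      rw [h1]
      have h2 : Real.exp (l * ⌊y⌋₊) ≤ Real.exp (l * y) :=
        Real.exp_le_exp.2 (mul_le_mul_of_nonneg_left (Nat.floor_le h) hl0.le)
      linarith
    · rw [Nat.floor_of_nonpos h.le, pow_zero]
      linarith [Real.exp_pos (l * y)]
  calc (n - n / Real.log n)⁻¹ * (1 + (q : ℝ)) ^ ⌊y⌋₊
      ≤ ((n : ℝ) / 2)⁻¹ * (1 + n * Real.exp (-(l * κ * Real.log n))) := by
        gcongr
    _ = _ := by field_simp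

/-! ### From failure probabilities to the stopping time, and the final assembly -/

/-- Informed sets only grow, so a success at `t` and a failure at `s` enclose the stopping time. -/
lemma exists_almostAllTime {n : ℕ} {pull : Bool} {v : Fin n} {ω : ℕ → Calls n} {t : ℕ}
    (h : informed (protocolStep pull) v ω t ∈ largeSets n (n - n / Real.log n)) :
    ∃ t' : ℕ, almostAllTime (protocolStep pull) v ω = t' ∧ t' ≤ t ∧
      ∀ s, informed (protocolStep pull) v ω s ∉ largeSets n (n - n / Real.log n) → s < t' := by
  classical
  have hex : ∃ t, (n : ℝ) - n / Real.log n ≤ ((informed (protocolStep pull) v ω t).card : ℝ) :=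
    ⟨t, h⟩
  refine ⟨Nat.find hex, le_antisymm (iInf₂_le (f := fun (t : ℕ)
      (_ : (n : ℝ) - n / Real.log n ≤ ((informed (protocolStep pull) v ω t).card : ℝ)) => (t : ℕ∞))
      (Nat.find hex) (Nat.find_spec hex))
    (le_iInf₂ fun s hs => by exact_mod_cast Nat.find_min' hex hs), Nat.find_min' hex h,
    fun s hs => ?_⟩
  by_contra hlt
  exact hs (largeSets_mono _ _ (Nat.find_spec hex) (informed_mono pull v ω (not_lt.1 hlt)))

/-- A diagonal argument: the parameter of a property that holds eventually for every positive value
of the parameter may tend to `0`. -/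
lemma exists_tendsto_zero_of_forall_eventually {P : ℝ → ℕ → Prop}
    (h : ∀ κ, 0 < κ → ∀ᶠ n in atTop, P κ n) :
    ∃ κ : ℕ → ℝ, (∀ n, 0 < κ n) ∧ Tendsto κ atTop (𝓝 0) ∧ ∀ᶠ n in atTop, P (κ n) n := by
  have h' : ∀ k : ℕ, ∃ N, ∀ n ≥ N, P (1 / ((k : ℝ) + 1)) n := fun k =>
    eventually_atTop.1 (h _ (by positivity))
  choose N hN using h'
  classical
  -- The largest `k ≤ n` whose threshold `N k` has been passed; it tends to infinity.
  let k : ℕ → ℕ := fun n => Nat.findGreatest (fun k => N k ≤ n) n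
  have hk : Tendsto k atTop atTop := tendsto_atTop.2 fun K => by
    filter_upwards [eventually_ge_atTop K, eventually_ge_atTop (N K)] with n h1 h2
    exact Nat.le_findGreatest h1 h2
  refine ⟨fun n => 1 / ((k n : ℝ) + 1), fun n => by positivity,
    tendsto_one_div_add_atTop_nhds_zero_nat.comp hk, ?_⟩
  filter_upwards [eventually_ge_atTop (N 0)] with n hn
  exact hN _ _ (Nat.findGreatest_spec (P := fun k => N k ≤ n) (Nat.zero_le n) hn)

/-- Errors of order `κ log n` for every `κ > 0` amount to an error of order `o(log n)`. -/
lemma exists_isLittleO_log {Q : (g : ℝ) → (n : ℕ) → Fin n → ℝ}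
    (h : ∀ κ, 0 < κ → ∀ᶠ n : ℕ in atTop, ∀ v : Fin n, 1 - κ ≤ Q (κ * Real.log n) n v) :
    ∃ g : ℕ → ℝ, (∀ n, 0 < g n) ∧ g =o[atTop] (fun n : ℕ => Real.log n) ∧
      ∀ η : ℝ, 0 < η → ∀ᶠ n : ℕ in atTop, ∀ v : Fin n, 1 - η ≤ Q (g n) n v := by
  obtain ⟨κ, hκ, hκ0, hP⟩ := exists_tendsto_zero_of_forall_eventually h
  have hev : ∀ᶠ n : ℕ in atTop, (if 2 ≤ n then κ n * Real.log n else 1) = κ n * Real.log n := by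
    filter_upwards [eventually_ge_atTop 2] with n hn
    rw [if_pos hn]
  -- For `n < 2` the logarithm vanishes; the value `1` keeps `g` positive there.
  refine ⟨fun n => if 2 ≤ n then κ n * Real.log n else 1, fun n => ?_, ?_, fun η hη => ?_⟩
  · beta_reduce
    split_ifs with hn
    · exact mul_pos (hκ n) (Real.log_pos (by exact_mod_cast hn))
    · exact one_pos
  · refine IsLittleO.congr' ?_ (EventuallyEq.symm hev) EventuallyEq.rfl
    have := ((isLittleO_one_iff ℝ).2 hκ0).mul_isBigO
      (isBigO_refl (fun n : ℕ => Real.log n) atTop)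
    simpa using this
  · filter_upwards [hP, hev, hκ0.eventually_le_const hη] with n h1 h2 h3 v
    rw [h2]
    exact (sub_le_sub_left h3 1).trans (h1 v)

end RumourSpreading

open RumourSpreading in
theorem mainTheorem4 (ε : ℝ) (hε₀ : 0 < ε) (hε₁ : ε < 1 / 2) (q : unitInterval) (hq : 0 < q)
    (G H : (n : ℕ) → SimpleGraph (Fin n))
    [∀ n, DecidableRel (G n).Adj] [∀ n, DecidableRel (H n).Adj]
    (hG : RumourSpreading.IsExpanderSequence G)
    (hH : ∀ n, RumourSpreading.IsDeletion (1 / 2 + ε) (G n) (H n)) :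
    (∃ g : ℕ → ℝ, (∀ n, 0 < g n) ∧ g =o[atTop] (fun n : ℕ => Real.log n) ∧
      ∀ η : ℝ, 0 < η → ∀ᶠ n : ℕ in atTop, ∀ v : Fin n,
        1 - η ≤ (RumourSpreading.callsLaw (H n) q).real
          {ω | ∃ t : ℕ, RumourSpreading.almostAllTime RumourSpreading.pushStep v ω = t ∧
            Real.logb (1 + q) n - g n ≤ t ∧ (t : ℝ) ≤ Real.logb (1 + q) n + g n}) ∧
    (∀ α : ℝ, 0 < α → α ≤ 1 → (∀ᶠ n : ℕ in atTop, α * n ≤ ((G n).minDegree : ℝ)) →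
      ∃ g : ℕ → ℝ, (∀ n, 0 < g n) ∧ g =o[atTop] (fun n : ℕ => Real.log n) ∧
      ∀ η : ℝ, 0 < η → ∀ᶠ n : ℕ in atTop, ∀ v : Fin n,
        1 - η ≤ (RumourSpreading.callsLaw (H n) q).real
          {ω | ∃ t : ℕ, RumourSpreading.almostAllTime RumourSpreading.pushPullStep v ω = t ∧
            (t : ℝ) ≤ Real.logb (1 + 2 * q) n + g n}) := by
  have hq0 : (0 : ℝ) < q := hq
  have hq1 : (q : ℝ) ≤ 1 := q.2.2
  have hc : 0 < q * ε / 8 := by positivity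
  have hc1 : q * ε / 8 ≤ 1 := by nlinarith
  have hdegs := eventually_degree_bounds hε₀ hG hH
  have hpos : ∀ᶠ n in atTop, ∀ v, 0 < (H n).degree v := by
    filter_upwards [hdegs] with n ⟨hδ, _, hdeg⟩ v
    have : (0 : ℝ) < (H n).degree v := lt_of_lt_of_le (by positivity) (hdeg v).1
    exact_mod_cast this
  refine ⟨?_, fun α hα hα₁ hdense => ?_⟩
  · refine exists_isLittleO_log (Q := fun g n v => (callsLaw (H n) q).real
      {ω | ∃ t : ℕ, almostAllTime pushStep v ω = t ∧
        Real.logb (1 + q) n - g ≤ t ∧ (t : ℝ) ≤ Real.logb (1 + q) n + g}) fun κ hκ => ?_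
    have hup := exists_time_failProb_almostAll_le H q false hq0 one_pos le_rfl hc hc1
      (eventually_cut_gain q hε₀ hε₁ hG hH false) (fun ξ hξ => ⟨ξ / 24, by positivity, by
        filter_upwards [eventually_push_growth q hε₀ hG hH hξ] with n hn
        exact ⟨fun _ => 1, fun _ => le_rfl, fun _ => le_rfl, fun J hJ => by simpa using hn J hJ⟩⟩)
      hκ (half_pos hκ)
    filter_upwards [hup, eventually_push_early_le H hq hpos hκ (half_pos hκ)]
      with n ⟨t, ht, hfail⟩ hearly v
    set s := ⌊Real.logb (1 + q) n - κ * Real.log n⌋₊ with hs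
    set A := largeSets n (n - n / Real.log n) with hA
    -- Either the time lies in the window, or the process is unfinished at `t`, or already finished
    -- at `s`; the last two have probability at most `κ / 2` each.
    have hcover : (Set.univ : Set (ℕ → Calls n)) ⊆
        {ω | ∃ t : ℕ, almostAllTime pushStep v ω = t ∧
          Real.logb (1 + q) n - κ * Real.log n ≤ t ∧
          (t : ℝ) ≤ Real.logb (1 + q) n + κ * Real.log n} ∪
        ({ω | informed (protocolStep false) v ω t ∉ A} ∪
          {ω | informed (protocolStep false) v ω s ∉ Aᶜ}) := by
      intro ω _
      by_cases h1 : informed (protocolStep false) v ω t ∈ A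
      · by_cases h2 : informed (protocolStep false) v ω s ∈ A
        · exact Or.inr (Or.inr fun h => h h2)
        · left
          obtain ⟨t', hT, ht', hlow⟩ := exists_almostAllTime h1
          have h3 : (s : ℝ) + 1 ≤ t' := by exact_mod_cast hlow s h2
          have h4 : (t' : ℝ) ≤ t := by exact_mod_cast ht'
          refine ⟨t', by rw [pushStep_eq]; exact hT,
            (Nat.lt_floor_add_one _).le.trans h3, h4.trans (ht.trans (le_of_eq ?_))⟩
          rw [Real.logb, div_eq_inv_mul]
      · exact Or.inr (Or.inl h1)
    have h1 := measureReal_mono (μ := callsLaw (H n) q) hcover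
    rw [probReal_univ] at h1
    have h2 := h1.trans (measureReal_union_le _ _)
    have h3 := measureReal_union_le (μ := callsLaw (H n) q)
      {ω | informed (protocolStep false) v ω t ∉ A} {ω | informed (protocolStep false) v ω s ∉ Aᶜ}
    rw [measureReal_informed_notMem, measureReal_informed_notMem] at h3
    have h4 := hfail v
    have h5 := hearly v
    linarith
  · refine exists_isLittleO_log (Q := fun g n v => (callsLaw (H n) q).real
      {ω | ∃ t : ℕ, almostAllTime pushPullStep v ω = t ∧
        (t : ℝ) ≤ Real.logb (1 + 2 * q) n + g}) fun κ hκ => ?_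
    obtain ⟨β, hβ⟩ : ∃ β, β = ε * α ^ 2 / 16 := ⟨_, rfl⟩
    have hβ0 : 0 < β := by rw [hβ]; positivity
    have hβ1 : β ≤ 1 := by rw [hβ]; nlinarith [mul_nonneg hα.le hα.le]
    -- The bounds on the weight depend only on `α` and `ε`, as the phase argument requires constants
    -- independent of `n`.
    have hab : β ^ ⌈β⁻¹⌉₊ / 2 ≤ (1 + 4 / α) ^ ⌈β⁻¹⌉₊ * (2 / α) := by
      have h1 : β ^ ⌈β⁻¹⌉₊ ≤ 1 := pow_le_one₀ hβ0.le hβ1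
      have h2 : 1 ≤ (1 + 4 / α) ^ ⌈β⁻¹⌉₊ := one_le_pow₀ (by
        have : 0 < 4 / α := by positivity
        linarith)
      have h3 : 1 ≤ 2 / α := by rw [one_le_div hα]; linarith
      nlinarith
    have hup := exists_time_failProb_almostAll_le H q true (γ := 2 * q) (by positivity)
      (by positivity) hab hc hc1 (eventually_cut_gain q hε₀ hε₁ hG hH true)
      (fun ξ hξ => ⟨ξ * α / 12, by positivity, by
        filter_upwards [eventually_cut hε₀ hε₁ hG hH, hdegs, hdense, eventually_gt_atTop 0]
          with n hcut ⟨_, _, hdeg⟩ hαn hn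
        have hdeg' : ∀ v, α * n / 2 ≤ ((H n).degree v : ℝ) := fun v => by
          linarith [(hdeg v).1]
        have hΔ : α * n ≤ ((G n).maxDegree : ℝ) :=
          hαn.trans (Nat.cast_le.2 (G n).minDegree_le_maxDegree)
        obtain ⟨φ, hφa, hφb, hsub⟩ := exists_weight hn hε₀ hε₁.le hα hα₁ hβ hdeg'
          fun S => le_trans (by gcongr) (hcut S)
        exact ⟨φ, hφa, hφb, fun J hJ => le_expectedGain_pushPull q hα hn hdeg'
          (fun w => le_trans (by positivity) (hφa w)) hsub hξ hJ⟩⟩) hκ hκ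
    filter_upwards [hup] with n ⟨t, ht, hfail⟩ v
    set A := largeSets n (n - n / Real.log n) with hA
    have hcover : (Set.univ : Set (ℕ → Calls n)) ⊆
        {ω | ∃ t : ℕ, almostAllTime pushPullStep v ω = t ∧
          (t : ℝ) ≤ Real.logb (1 + 2 * q) n + κ * Real.log n} ∪
        {ω | informed (protocolStep true) v ω t ∉ A} := by
      intro ω _
      by_cases h1 : informed (protocolStep true) v ω t ∈ A
      · left
        obtain ⟨t', hT, ht', -⟩ := exists_almostAllTime h1
        have h4 : (t' : ℝ) ≤ t := by exact_mod_cast ht'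
        refine ⟨t', by rw [pushPullStep_eq]; exact hT, h4.trans (ht.trans (le_of_eq ?_))⟩
        rw [Real.logb, div_eq_inv_mul]
      · exact Or.inr h1
    have h1 := measureReal_mono (μ := callsLaw (H n) q) hcover
    rw [probReal_univ] at h1
    have h2 := h1.trans (measureReal_union_le _ _)
    rw [measureReal_informed_notMem] at h2
    have h4 := hfail v
    linarith
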